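/- Let $A$ be a unital $C^*$-algebra, let $\alpha:A\to A$ be a $*$-endomorphism (not assumed unital or injective), and let $L$ be a transfer operator for $(A,\alpha)$, that is, a continuous positive linear map $L:A\to A$ with $L(\alpha(a)b)=aL(b)$ for all $a,b\in A$. *The bimodule.* On a copy $A_L$ of the vector space $A$ put $m\cdot a=m\alpha(a)$ and $\langle m,n\rangle_L=L(m^*n)$. Let $N=\{m\in A_L:\langle m,m\rangle_L=0\}$, let $M_L$ be the right Hilbert $A$-module obtained by completing $A_L/N$, and let $q:A\to M_L$ be the canonical map. Left multiplication on $A_L$ induces a homomorphism $\phi:A\to\mathcal L(M_L)$, $\phi(a)q(b)=q(ab)$, which makes $M_L$ a Hilbert bimodule over $A$. *Relative Cuntz--Pimsner algebras.* For a Hilbert bimodule $X$ over $A$ with left action $\phi$, let $\mathcal K(X)$ be the closed linear span of the operators $\Theta_{x,y}:z\mapsto x\cdot\langle y,z\rangle_A$, and let $J(X)=\phi^{-1}(\mathcal K(X))$. A Toeplitz representation of $X$ in a $C^*$-algebra $B$ is a pair $(\psi,\pi)$ of a linear map $\psi:X\to B$ and a $*$-homomorphism $\pi:A\to B$ with $\psi(x\cdot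 a)=\psi(x)\pi(a)$, $\psi(x)^*\psi(y)=\pi(\langle x,y\rangle_A)$ and $\psi(\phi(a)x)=\pi(a)\psi(x)$; it induces a homomorphism $(\psi,\pi)^{(1)}:\mathcal K(X)\to B$ with $(\psi,\pi)^{(1)}(\Theta_{x,y})=\psi(x)\psi(y)^*$. For an ideal $K\subseteq J(X)$ of $A$, $(\psi,\pi)$ is coisometric on $K$ if $(\psi,\pi)^{(1)}(\phi(a))=\pi(a)$ for all $a\in K$. The algebra $\mathcal O(K,X)$ is the $C^*$-algebra generated by a Toeplitz representation $(k_X,k_A)$ of $X$ that is universal among the Toeplitz representations that are coisometric on $K$. The Cuntz--Pimsner algebra of $X$ is $\mathcal O(X)=\mathcal O(J(X),X)$. *The crossed product.* Let $\mathcal T(A,\alpha,L)$ be the universal unital $C^*$-algebra generated by the image of a unital $*$-homomorphism $i_A$ of $A$ and an element $S$ such that $S\,i_A(a)=i_A(\alpha(a))S$ and $S^*i_A(a)S=i_A(L(a))$ for all $a\in A$. A redundancy is a pair $(i_A(a),k)$ with $a\in A$, $k$ in the closed linear span of $i_A(A)SS^*i_A(A)$, and $i_A(a)i_A(b)S=k\,i_A(b)S$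 for all $b\in A$. Exel's crossed product $A\rtimes_{\alpha,L}\mathbb N$ is the quotient of $\mathcal T(A,\alpha,L)$ by the closed two-sided ideal generated by the elements $i_A(a)-k$, where $(i_A(a),k)$ is a redundancy with $a\in\overline{A\alpha(A)A}$ (closed linear span). With $Q$ the quotient map, put $j_A=Q\circ i_A$ and $T=Q(S)$. Finally, let $K_\alpha=\overline{A\alpha(A)A}\cap J(M_L)$. **Proposition.** There is a $*$-isomorphism $\theta:\mathcal O(K_\alpha,M_L)\to A\rtimes_{\alpha,L}\mathbb N$ such that $\theta\circ k_A=j_A$ and $\theta(k_{M_L}(q(1)))=T$. If moreover $\alpha(1)=1$, then $K_\alpha=J(M_L)$, so that $A\rtimes_{\alpha,L}\mathbb N$ is the Cuntz--Pimsner algebra: there is a $*$-isomorphism $\theta:\mathcal O(M_L)\to A\rtimes_{\alpha,L}\mathbb N$ such that $\theta\circ k_A=j_A$ and $\theta(k_{M_L}(q(1)))=T$. -/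

import Mathlib

open Filter Topology
open scoped ENNReal

universe u v w

set_option linter.unusedSectionVars false
set_option linter.checkUnivs false

noncomputable section

/-! ### Right Hilbert modules and Hilbert bimodules

The class `CStarModule` of Mathlib has the rule `⟪x, a • y⟫ = a * ⟪x, y⟫`, that is, it describes
left actions. The modules below are right modules, with `⟪x, y · a⟫ = ⟪x, y⟫ * a`. -/

/-- A right module over a C⋆-algebra `A` (with action `act x a = x · a`) and an `A`-valued
semi-inner product, linear in the second variable. -/
class PreHilbertModule (A : Type u) (E : Type v) [NonUnitalCStarAlgebra A] [PartialOrder A]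
    [AddCommGroup E] [Module ℂ E] where
  ip : E → E → A
  act : E → A → E
  add_act (x y : E) (a : A) : act (x + y) a = act x a + act y a
  act_add (x : E) (a b : A) : act x (a + b) = act x a + act x b
  act_mul (x : E) (a b : A) : act x (a * b) = act (act x a) b
  smul_act (c : ℂ) (x : E) (a : A) : act (c • x) a = c • act x a
  act_smul (c : ℂ) (x : E) (a : A) : act x (c • a) = c • act x a
  ip_add_right (x y z : E) : ip x (y + z) = ip x y + ip x z
  ip_smul_right (c : ℂ) (x y : E) : ip x (c • y) = c • ip x y
  ip_act_right (x y : E) (a : A) : ip x (act y a) = ip x y * a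
  star_ip (x y : E) : star (ip x y) = ip y x
  ip_self_nonneg (x : E) : 0 ≤ ip x x

namespace PreHilbertModule

variable {A : Type u} {E : Type v} [NonUnitalCStarAlgebra A] [PartialOrder A]
  [AddCommGroup E] [Module ℂ E] [PreHilbertModule A E]

theorem ip_add_left (x y z : E) : ip (A := A) (x + y) z = ip x z + ip y z := by
  rw [← star_ip, ip_add_right, star_add, star_ip, star_ip]

theorem ip_smul_left (c : ℂ) (x y : E) : ip (A := A) (c • x) y = star c • ip x y := by
  rw [← star_ip, ip_smul_right, star_smul, star_ip]

theorem ip_act_left (x y : E) (a : A) : ip (act x a) y = star a * ip x y := by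
  rw [← star_ip, ip_act_right, star_mul, star_ip]

theorem ip_sub_right (x y z : E) : ip (A := A) x (y - z) = ip x y - ip x z := by
  rw [sub_eq_add_neg, ← neg_one_smul ℂ z, ip_add_right, ip_smul_right, neg_one_smul,
    sub_eq_add_neg]

theorem ip_sub_left (x y z : E) : ip (A := A) (x - y) z = ip x z - ip y z := by
  rw [← star_ip, ip_sub_right, star_sub, star_ip, star_ip]

variable [StarOrderedRing A]

/-- The Cauchy–Schwarz inequality. -/
theorem norm_ip_sq_le (x y : E) :
    ‖ip (A := A) x y‖ ^ 2 ≤ ‖ip (A := A) x x‖ * ‖ip (A := A) y y‖ := by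
  set a : A := ip x y with ha
  -- the inequality with a positive parameter in place of the norm of `ip x x`
  have key : ∀ t : ℝ, 0 < t → ‖ip (A := A) x x‖ ≤ t → ‖a‖ ^ 2 ≤ t * ‖ip (A := A) y y‖ := by
    intro t ht hxt
    have h0 : 0 ≤ ip (A := A) (act x a - (t : ℂ) • y) (act x a - (t : ℂ) • y) :=
      ip_self_nonneg _
    have hya : ip (A := A) y x = star a := by rw [ha, star_ip]
    have e1 : ip (A := A) (act x a - (t : ℂ) • y) (act x a - (t : ℂ) • y)
        = star a * ip x x * a - (2 * t) • (star a * a) + (t ^ 2) • ip (A := A) y y := by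
      simp only [ip_sub_right, ip_sub_left, ip_act_right, ip_act_left, ip_smul_left,
        ip_smul_right, hya, ← ha, smul_sub]
      simp only [Complex.star_def, Complex.conj_ofReal, Complex.coe_smul, two_mul, add_smul, pow_two,
        mul_smul, sub_mul, smul_mul_assoc]
      abel
    have h2 : star a * ip x x * a ≤ t • (star a * a) := by
      have := CStarAlgebra.star_left_conjugate_le_norm_smul (a := a) (b := ip (A := A) x x)
        (hb := by rw [IsSelfAdjoint, star_ip])
      refine this.trans ?_
      have : 0 ≤ (t - ‖ip (A := A) x x‖) • (star a * a) :=
        smul_nonneg (sub_nonneg.2 hxt) (star_mul_self_nonneg a)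
      rwa [sub_smul, sub_nonneg] at this
    have h3 : t • (star a * a) ≤ (t ^ 2) • ip (A := A) y y := by
      rw [e1] at h0
      have := h0.trans (add_le_add_left (sub_le_sub_right h2 ((2 * t) • (star a * a)))
        ((t ^ 2) • ip (A := A) y y))
      have e : t • (star a * a) - (2 * t) • (star a * a) = - (t • (star a * a)) := by
        rw [two_mul, add_smul]; abel
      rw [e, neg_add_eq_sub, sub_nonneg] at this
      exact this
    have h4 := CStarAlgebra.norm_le_norm_of_nonneg_of_le
      (smul_nonneg ht.le (star_mul_self_nonneg a)) h3
    rw [norm_smul, norm_smul, CStarRing.norm_star_mul_self, Real.norm_of_nonneg ht.le,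
      Real.norm_of_nonneg (by positivity), pow_two t, mul_assoc] at h4
    have := le_of_mul_le_mul_left h4 ht
    rwa [pow_two]
  refine le_of_forall_pos_le_add fun ε hε => ?_
  have hp : 0 < ‖ip (A := A) y y‖ + 1 := by positivity
  have := key (‖ip (A := A) x x‖ + ε / (‖ip (A := A) y y‖ + 1)) (by positivity)
    (by have : 0 < ε / (‖ip (A := A) y y‖ + 1) := by positivity
        linarith)
  refine this.trans ?_
  rw [add_mul]
  gcongr
  rw [div_mul_eq_mul_div, div_le_iff₀ hp]
  nlinarith [norm_nonneg (ip (A := A) y y)]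

theorem norm_ip_le (x y : E) :
    ‖ip (A := A) x y‖ ≤ √‖ip (A := A) x x‖ * √‖ip (A := A) y y‖ := by
  rw [← Real.sqrt_mul (norm_nonneg _)]
  exact Real.le_sqrt_of_sq_le (norm_ip_sq_le x y)

/-- The seminorm `‖x‖ = ‖⟪x, x⟫‖ ^ (1 / 2)` of a semi-inner product. -/
theorem seminormCore (A : Type u) (E : Type v) [NonUnitalCStarAlgebra A] [PartialOrder A]
    [AddCommGroup E] [Module ℂ E] [PreHilbertModule A E] [StarOrderedRing A] :
    letI : Norm E := ⟨fun x => √‖ip (A := A) x x‖⟩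
    SeminormedSpace.Core ℂ E :=
  letI : Norm E := ⟨fun x => √‖ip (A := A) x x‖⟩
  { norm_nonneg := fun x => Real.sqrt_nonneg _
    norm_smul := fun c x => by
      change √‖ip (A := A) (c • x) (c • x)‖ = ‖c‖ * √‖ip (A := A) x x‖
      rw [ip_smul_left, ip_smul_right, norm_smul, norm_smul, norm_star, ← mul_assoc,
        Real.sqrt_mul (by positivity), Real.sqrt_mul_self (norm_nonneg _)]
    norm_triangle := fun x y => by
      change √‖ip (A := A) (x + y) (x + y)‖ ≤ √‖ip (A := A) x x‖ + √‖ip (A := A) y y‖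
      refine Real.sqrt_le_iff.2 ⟨by positivity, ?_⟩
      have h1 := norm_ip_le (A := A) x y
      have h2 := norm_ip_le (A := A) y x
      have h3 : ‖ip (A := A) (x + y) (x + y)‖ ≤ ‖ip (A := A) x x‖ + ‖ip (A := A) y x‖ +
          (‖ip (A := A) x y‖ + ‖ip (A := A) y y‖) := by
        rw [ip_add_right, ip_add_left, ip_add_left]
        exact (norm_add_le _ _).trans (add_le_add (norm_add_le _ _) (norm_add_le _ _))
      have h4 := Real.sq_sqrt (norm_nonneg (ip (A := A) x x))
      have h5 := Real.sq_sqrt (norm_nonneg (ip (A := A) y y))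
      nlinarith }

end PreHilbertModule

/-- A right Hilbert module over a C⋆-algebra `A`. -/
class HilbertModule (A : Type u) (X : Type v) [NonUnitalCStarAlgebra A] [PartialOrder A]
    [NormedAddCommGroup X] [NormedSpace ℂ X] [CompleteSpace X] extends
    PreHilbertModule A X where
  norm_sq_eq (x : X) : ‖x‖ ^ 2 = ‖ip x x‖

/-- A Hilbert bimodule over `A`: a right Hilbert module `X` with a left action given by a
homomorphism `φ` of `A` into the C⋆-algebra `𝓛(X)` of adjointable operators on `X`. The last
field says that every `φ a` is adjointable with adjoint `φ (star a)`. -/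
class HilbertBimodule (A : Type u) (X : Type v) [NonUnitalCStarAlgebra A] [PartialOrder A]
    [NormedAddCommGroup X] [NormedSpace ℂ X] [CompleteSpace X] extends
    HilbertModule A X where
  φ : A →ₙₐ[ℂ] (X →L[ℂ] X)
  ip_φ_left (a : A) (x y : X) : ip (φ a x) y = ip x (φ (star a) y)

namespace HilbertModule

open PreHilbertModule

variable {A : Type u} {X : Type v} [NonUnitalCStarAlgebra A] [PartialOrder A]
  [StarOrderedRing A] [NormedAddCommGroup X] [NormedSpace ℂ X] [CompleteSpace X]
  [HilbertModule A X]

theorem norm_ip_le_mul (x y : X) : ‖ip (A := A) x y‖ ≤ ‖x‖ * ‖y‖ := by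
  have := norm_ip_le (A := A) x y
  rwa [← norm_sq_eq, ← norm_sq_eq, Real.sqrt_sq (norm_nonneg _), Real.sqrt_sq (norm_nonneg _)]
    at this

theorem norm_act_le (x : X) (a : A) : ‖act x a‖ ≤ ‖x‖ * ‖a‖ := by
  refine le_of_sq_le_sq ?_ (by positivity)
  rw [norm_sq_eq (A := A), ip_act_left, ip_act_right, mul_pow, norm_sq_eq (A := A) x]
  calc _ ≤ ‖star a‖ * (‖ip (A := A) x x‖ * ‖a‖) :=
        (norm_mul_le _ _).trans (by gcongr; exact norm_mul_le _ _)
    _ = _ := by rw [norm_star]; ring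

/-- The rank-one operator `Θ_{x,y} : z ↦ x · ⟪y, z⟫`. -/
def theta (A : Type u) {X : Type v} [NonUnitalCStarAlgebra A] [PartialOrder A]
    [StarOrderedRing A] [NormedAddCommGroup X] [NormedSpace ℂ X] [CompleteSpace X]
    [HilbertModule A X] (x y : X) : X →L[ℂ] X :=
  LinearMap.mkContinuous
    { toFun := fun z => act x (ip (A := A) y z)
      map_add' := fun z z' => by rw [ip_add_right, act_add]
      map_smul' := fun c z => by rw [ip_smul_right, act_smul]; rfl }
    (‖x‖ * ‖y‖) fun z => by
      refine (norm_act_le (A := A) x _).trans ?_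
      rw [mul_assoc]
      gcongr
      exact norm_ip_le_mul y z

theorem theta_apply (x y z : X) : theta A x y z = act x (ip (A := A) y z) := rfl

/-- The compact operators `𝓚(X)`: the closed linear span of the operators `Θ_{x,y}`. -/
def compacts (A : Type u) (X : Type v) [NonUnitalCStarAlgebra A] [PartialOrder A]
    [StarOrderedRing A] [NormedAddCommGroup X] [NormedSpace ℂ X] [CompleteSpace X]
    [HilbertModule A X] : Submodule ℂ (X →L[ℂ] X) :=
  (Submodule.span ℂ {T | ∃ x y : X, T = theta A x y}).topologicalClosure

theorem theta_mem_compacts (x y : X) : theta A x y ∈ compacts A X :=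
  Submodule.le_topologicalClosure _ (Submodule.subset_span ⟨x, y, rfl⟩)

end HilbertModule

namespace HilbertModule

open PreHilbertModule

section Toeplitz

variable {A : Type u} {X : Type v} {B : Type w} [NonUnitalCStarAlgebra A] [PartialOrder A]
  [StarOrderedRing A] [NormedAddCommGroup X] [NormedSpace ℂ X] [CompleteSpace X]
  [NonUnitalCStarAlgebra B]

instance [HilbertModule A X] : IsBoundedSMul ℂ (compacts A X) :=
  IsBoundedSMul.of_norm_smul_le fun c x => norm_smul_le c (x : X →L[ℂ] X)

/-! ### Toeplitz representations -/

/-- A Toeplitz representation `(ψ, π)` of a Hilbert bimodule `X` over `A` in a C⋆-algebra `B`. -/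
structure IsToeplitzRep [HilbertBimodule A X] (ψ : X →ₗ[ℂ] B) (π : A →⋆ₙₐ[ℂ] B) : Prop where
  map_act (x : X) (a : A) : ψ (act x a) = ψ x * π a
  star_mul (x y : X) : star (ψ x) * ψ y = π (ip x y)
  map_φ (a : A) (x : X) : ψ (HilbertBimodule.φ a x) = π a * ψ x

theorem IsToeplitzRep.norm_le [HilbertBimodule A X] {ψ : X →ₗ[ℂ] B} {π : A →⋆ₙₐ[ℂ] B}
    (h : IsToeplitzRep ψ π) (x : X) : ‖ψ x‖ ≤ ‖x‖ := by
  refine le_of_sq_le_sq ?_ (norm_nonneg _)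
  rw [pow_two, ← CStarRing.norm_star_mul_self, h.star_mul, norm_sq_eq (A := A)]
  exact NonUnitalStarAlgHom.norm_apply_le π _

/-- The map `∑ cᵢ (xᵢ, yᵢ) ↦ ∑ cᵢ Θ_{xᵢ,yᵢ}` on formal linear combinations of pairs. -/
def thetaSum (A : Type u) (X : Type v) [NonUnitalCStarAlgebra A] [PartialOrder A]
    [StarOrderedRing A] [NormedAddCommGroup X] [NormedSpace ℂ X] [CompleteSpace X]
    [HilbertModule A X] : (X × X →₀ ℂ) →ₗ[ℂ] compacts A X :=
  Finsupp.linearCombination ℂ fun p : X × X => ⟨theta A p.1 p.2, theta_mem_compacts p.1 p.2⟩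

/-- The map `∑ cᵢ (xᵢ, yᵢ) ↦ ∑ cᵢ ψ(xᵢ) ψ(yᵢ)⋆` on formal linear combinations of pairs. -/
def psiSum (ψ : X →ₗ[ℂ] B) : (X × X →₀ ℂ) →ₗ[ℂ] B :=
  Finsupp.linearCombination ℂ fun p : X × X => ψ p.1 * star (ψ p.2)

/-- The map `(ψ, π)⁽¹⁾ : 𝓚(X) → B` of a Toeplitz representation `(ψ, π)`: the continuous linear
extension of `∑ cᵢ Θ_{xᵢ,yᵢ} ↦ ∑ cᵢ ψ(xᵢ) ψ(yᵢ)⋆`. By `onePart_theta` it maps `Θ_{x,y}` to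
`ψ(x) ψ(y)⋆`, and by continuity and linearity it is the only such map. -/
def onePart [HilbertBimodule A X] {ψ : X →ₗ[ℂ] B} {π : A →⋆ₙₐ[ℂ] B}
    (_h : IsToeplitzRep ψ π) : compacts A X →L[ℂ] B :=
  (psiSum ψ).extendOfNorm (thetaSum A X)

theorem denseRange_thetaSum [HilbertModule A X] : DenseRange (thetaSum A X) := by
  have h : ((fun T : compacts A X => (T : X →L[ℂ] X)) '' Set.range (thetaSum A X)) =
      (Submodule.span ℂ {T | ∃ x y : X, T = theta A x y} : Set (X →L[ℂ] X)) := by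
    have e : {T | ∃ x y : X, T = theta A x y} =
        Set.range (fun p : X × X => theta A p.1 p.2) := by
      ext T
      exact ⟨fun ⟨x, y, h⟩ => ⟨(x, y), h.symm⟩, fun ⟨p, h⟩ => ⟨p.1, p.2, h.symm⟩⟩
    rw [e, ← Finsupp.range_linearCombination, ← Set.range_comp, LinearMap.coe_range]
    congr 1
    ext s : 1
    simp [thetaSum, Finsupp.linearCombination_apply, Finsupp.sum]
  rw [DenseRange, Subtype.dense_iff]
  intro T hT
  exact h.symm ▸ hT

theorem le_of_pow_two_pow_le {a r M : ℝ} (hr : 0 < r)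
    (h : ∀ k : ℕ, a ^ (2 ^ k) ≤ M * r ^ (2 ^ k)) : a ≤ r := by
  by_contra! hlt
  have ha : 0 < a := hr.trans hlt
  have h1 : Tendsto (fun k : ℕ => M * (r / a) ^ (2 ^ k)) atTop (𝓝 (M * 0)) := by
    refine Tendsto.const_mul _ ?_
    refine (tendsto_pow_atTop_nhds_zero_of_lt_one (by positivity) ?_).comp
      (tendsto_pow_atTop_atTop_of_one_lt (by norm_num : (1 : ℕ) < 2))
    rwa [div_lt_one ha]
  have h2 : ∀ k : ℕ, 1 ≤ M * (r / a) ^ (2 ^ k) := by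
    intro k
    rw [div_pow, mul_div_assoc', le_div_iff₀ (by positivity), one_mul]
    exact h k
  have h3 := ge_of_tendsto' h1 h2
  norm_num at h3

theorem norm_psiSum_le [HilbertBimodule A X] {ψ : X →ₗ[ℂ] B} {π : A →⋆ₙₐ[ℂ] B}
    (h : IsToeplitzRep ψ π) (s : X × X →₀ ℂ) : ‖psiSum ψ s‖ ≤ 1 * ‖thetaSum A X s‖ := by
  classical
  set T : X →L[ℂ] X := (thetaSum A X s : X →L[ℂ] X) with hTdef
  set b : B := psiSum ψ s with hbdef
  have hT : T = ∑ p ∈ s.support, s p • theta A p.1 p.2 := by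
    simp [hTdef, thetaSum, Finsupp.linearCombination_apply, Finsupp.sum]
  have hb : b = ∑ p ∈ s.support, s p • (ψ p.1 * star (ψ p.2)) := by
    simp [hbdef, psiSum, Finsupp.linearCombination_apply, Finsupp.sum]
  -- the adjoint of `T`
  set T' : X →L[ℂ] X := ∑ p ∈ s.support, star (s p) • theta A p.2 p.1 with hT'
  have hθ : ∀ x y z : X, ψ (theta A x y z) = ψ x * star (ψ y) * ψ z := by
    intro x y z
    rw [theta_apply, h.map_act, ← h.star_mul, mul_assoc]
  have hbψ : ∀ z, b * ψ z = ψ (T z) := by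
    intro z
    simp only [hb, hT, Finset.sum_mul, _root_.sum_apply, map_sum,
      _root_.smul_apply, map_smul, hθ, smul_mul_assoc]
  have hb'ψ : ∀ z, star b * ψ z = ψ (T' z) := by
    intro z
    simp only [hb, hT', Finset.sum_mul, _root_.sum_apply, map_sum, star_sum,
      star_smul, star_mul, star_star,
      _root_.smul_apply, map_smul, hθ, smul_mul_assoc]
  have hadd : ∀ (f : X × X → X) (t : Finset (X × X)) (y : X),
      ip (A := A) (∑ p ∈ t, f p) y = ∑ p ∈ t, ip (A := A) (f p) y := by
    intro f t y
    exact map_sum (AddMonoidHom.mk' (fun x => ip (A := A) x y) fun x x' => ip_add_left x x' y) f t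
  have hadd' : ∀ (f : X × X → X) (t : Finset (X × X)) (y : X),
      ip (A := A) y (∑ p ∈ t, f p) = ∑ p ∈ t, ip (A := A) y (f p) := by
    intro f t y
    exact map_sum (AddMonoidHom.mk' (fun x => ip (A := A) y x) fun x x' => ip_add_right y x x') f t
  have hadj : ∀ x y : X, ip (A := A) (T x) y = ip x (T' y) := by
    intro x y
    simp only [hT, hT', _root_.sum_apply, hadd, hadd',
      _root_.smul_apply, ip_smul_left, ip_smul_right, theta_apply, ip_act_left,
      ip_act_right, star_ip]
  have hTT' : ‖T'‖ ≤ ‖T‖ := by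
    refine ContinuousLinearMap.opNorm_le_bound _ (norm_nonneg _) fun x => ?_
    have h1 : ‖T' x‖ ^ 2 ≤ ‖T‖ * ‖T' x‖ * ‖x‖ := by
      rw [norm_sq_eq (A := A), ← hadj]
      refine (norm_ip_le_mul _ _).trans ?_
      gcongr
      exact T.le_opNorm _
    rcases (norm_nonneg (T' x)).eq_or_lt with h0 | h0
    · rw [← h0]; positivity
    · rw [pow_two] at h1
      refine le_of_mul_le_mul_right (a := ‖T' x‖) ?_ h0
      linarith
  -- the operators `∑ cᵢ ψ(R xᵢ) ψ(yᵢ)⋆`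
  let Φ : (X →L[ℂ] X) → B := fun R => ∑ p ∈ s.support, s p • (ψ (R p.1) * star (ψ p.2))
  set M : ℝ := ∑ p ∈ s.support, ‖s p‖ * (‖p.1‖ * ‖p.2‖) with hM
  have hΦ : ∀ R, ‖Φ R‖ ≤ ‖R‖ * M := by
    intro R
    refine (norm_sum_le _ _).trans ?_
    rw [hM, Finset.mul_sum]
    refine Finset.sum_le_sum fun p _ => ?_
    rw [norm_smul]
    calc ‖s p‖ * ‖ψ (R p.1) * star (ψ p.2)‖ ≤ ‖s p‖ * ((‖R‖ * ‖p.1‖) * ‖p.2‖) := by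
          gcongr
          refine (norm_mul_le _ _).trans ?_
          rw [norm_star]
          gcongr
          · exact (h.norm_le _).trans (R.le_opNorm _)
          · exact h.norm_le _
      _ = _ := by ring
  set d : B := star b * b with hd
  have main : ∀ r : ℝ, ‖T‖ ^ 2 < r → ‖d‖ ≤ r := by
    intro r hr
    have hr0 : 0 < r := (sq_nonneg _).trans_lt hr
    have step : ∀ k : ℕ, ∃ (e : B) (Q R : X →L[ℂ] X), star e = e ∧ ‖e‖ = ‖d‖ ^ (2 ^ k) ∧
        (∀ z, e * ψ z = ψ (Q z)) ∧ e = Φ R ∧ ‖Q‖ ≤ r ^ (2 ^ k) ∧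
        ‖R‖ * r ≤ r ^ (2 ^ k) * ‖T'‖ := by
      intro k
      induction k with
      | zero =>
        refine ⟨d, T'.comp T, T', by simp [hd], by simp, fun z => ?_, ?_, ?_, ?_⟩
        · rw [hd, mul_assoc, hbψ, hb'ψ]; rfl
        · rw [hd, hb, Finset.mul_sum, ← hb]
          refine Finset.sum_congr rfl fun p _ => ?_
          rw [mul_smul_comm, ← mul_assoc, hb'ψ]
        · refine (ContinuousLinearMap.opNorm_comp_le _ _).trans ?_
          rw [pow_zero, pow_one]
          refine le_trans ?_ hr.le
          rw [pow_two]
          gcongr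
        · rw [pow_zero, pow_one, mul_comm]
      | succ k ih =>
        obtain ⟨e, Q, R, h1, h2, h3, h4, h5, h6⟩ := ih
        refine ⟨e * e, Q.comp Q, Q.comp R, by rw [star_mul, h1], ?_, fun z => ?_, ?_, ?_, ?_⟩
        · nth_rewrite 1 [← h1]
          rw [CStarRing.norm_star_mul_self, h2, ← pow_two, ← pow_mul, pow_succ]
        · rw [mul_assoc, h3, h3]; rfl
        · nth_rewrite 2 [h4]
          simp only [Φ, Finset.mul_sum, mul_smul_comm, ← mul_assoc, h3]
          rfl
        · refine (ContinuousLinearMap.opNorm_comp_le _ _).trans ?_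
          rw [pow_succ, pow_mul, pow_two]
          gcongr
        · calc ‖Q.comp R‖ * r ≤ ‖Q‖ * ‖R‖ * r := by
                gcongr; exact ContinuousLinearMap.opNorm_comp_le _ _
            _ = ‖Q‖ * (‖R‖ * r) := by ring
            _ ≤ r ^ (2 ^ k) * (r ^ (2 ^ k) * ‖T'‖) := by gcongr
            _ = _ := by rw [pow_succ 2 k, pow_mul, pow_two]; ring
    refine le_of_pow_two_pow_le (M := ‖T'‖ * M / r) hr0 fun k => ?_
    obtain ⟨e, Q, R, h1, h2, h3, h4, h5, h6⟩ := step k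
    rw [← h2, h4, div_mul_eq_mul_div, le_div_iff₀ hr0]
    have hM0 : 0 ≤ M := Finset.sum_nonneg fun p _ => by positivity
    calc ‖Φ R‖ * r ≤ ‖R‖ * M * r := by gcongr; exact hΦ R
      _ = M * (‖R‖ * r) := by ring
      _ ≤ M * (r ^ (2 ^ k) * ‖T'‖) := by gcongr
      _ = _ := by ring
  have hfin : ‖b‖ ^ 2 ≤ ‖T‖ ^ 2 := by
    rw [pow_two, ← CStarRing.norm_star_mul_self]
    exact le_of_forall_gt_imp_ge_of_dense main
  rw [one_mul]
  exact le_of_sq_le_sq hfin (norm_nonneg _)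

theorem onePart_theta [HilbertBimodule A X] {ψ : X →ₗ[ℂ] B} {π : A →⋆ₙₐ[ℂ] B}
    (h : IsToeplitzRep ψ π) (x y : X) :
    onePart h ⟨theta A x y, theta_mem_compacts x y⟩ = ψ x * star (ψ y) := by
  have := LinearMap.extendOfNorm_eq (f := psiSum ψ) (denseRange_thetaSum (A := A) (X := X))
    ⟨1, norm_psiSum_le h⟩ (Finsupp.single (x, y) 1)
  simpa [thetaSum, psiSum, onePart] using this

end Toeplitz

section Ideal

variable (A : Type u) (X : Type v) [NonUnitalCStarAlgebra A] [PartialOrder A]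
  [StarOrderedRing A] [NormedAddCommGroup X] [NormedSpace ℂ X] [CompleteSpace X]

theorem compacts_induction [HilbertModule A X] (F : (X →L[ℂ] X) →L[ℂ] (X →L[ℂ] X))
    (hF : ∀ x y, F (theta A x y) ∈ compacts A X) {T : X →L[ℂ] X} (hT : T ∈ compacts A X) :
    F T ∈ compacts A X := by
  have hle : Submodule.span ℂ {T | ∃ x y : X, T = theta A x y} ≤
      (compacts A X).comap F.toLinearMap := by
    rw [Submodule.span_le]
    rintro _ ⟨x, y, rfl⟩
    exact hF x y
  have hc : IsClosed ((compacts A X).comap F.toLinearMap : Set (X →L[ℂ] X)) :=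
    (Submodule.isClosed_topologicalClosure _).preimage F.continuous
  exact Submodule.topologicalClosure_minimal _ hle hc hT

variable {A X} in
theorem ext_ip [HilbertModule A X] {x y : X} (h : ∀ z : X, ip (A := A) z x = ip z y) :
    x = y := by
  have h0 : ‖x - y‖ ^ 2 = 0 := by
    rw [norm_sq_eq (A := A), ip_sub_right, h, sub_self, norm_zero]
  exact sub_eq_zero.1 (norm_eq_zero.1 (pow_eq_zero_iff two_ne_zero |>.1 h0))

variable {A X} in
theorem φ_act [HilbertBimodule A X] (a : A) (x : X) (b : A) :
    HilbertBimodule.φ a (act x b) = act (HilbertBimodule.φ a x) b := by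
  refine ext_ip (A := A) fun z => ?_
  have h : ∀ y : X, ip (A := A) z (HilbertBimodule.φ a y) =
      ip (HilbertBimodule.φ (star a) z) y := fun y => by
    rw [HilbertBimodule.ip_φ_left, star_star]
  rw [h, ip_act_right, ip_act_right, h]

/-- The ideal `J(X) = φ⁻¹(𝓚(X))` of `A`. -/
def JIdeal [HilbertBimodule A X] : TwoSidedIdeal A :=
  TwoSidedIdeal.mk' {a | HilbertBimodule.φ (X := X) a ∈ compacts A X}
    (by simp only [Set.mem_ofPred_eq, map_zero]; exact zero_mem _)
    (fun {a b} ha hb => by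
      simp only [Set.mem_ofPred_eq, map_add] at *; exact add_mem ha hb)
    (fun {a} ha => by simp only [Set.mem_ofPred_eq, map_neg] at *; exact neg_mem ha)
    (fun {a b} hb => by
      simp only [Set.mem_ofPred_eq, map_mul] at *
      refine compacts_induction A X (ContinuousLinearMap.mul ℂ (X →L[ℂ] X)
        (HilbertBimodule.φ a)) (fun x y => ?_) hb
      convert! theta_mem_compacts (A := A) (HilbertBimodule.φ a x : X) y using 1
      ext z
      exact φ_act a x _)
    (fun {a b} ha => by
      simp only [Set.mem_ofPred_eq, map_mul] at *
      refine compacts_induction A X ((ContinuousLinearMap.mul ℂ (X →L[ℂ] X)).flip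
        (HilbertBimodule.φ b)) (fun x y => ?_) ha
      convert! theta_mem_compacts (A := A) x (HilbertBimodule.φ (star b) y : X) using 1
      ext z
      simp [theta_apply, HilbertBimodule.ip_φ_left])

theorem mem_JIdeal [HilbertBimodule A X] (a : A) :
    a ∈ JIdeal A X ↔ HilbertBimodule.φ (X := X) a ∈ compacts A X :=
  TwoSidedIdeal.mem_mk' ..

end Ideal

end HilbertModule

/-! ### Universal C⋆-algebras -/

/-- A family of maps of a set `G` of generators into C⋆-algebras, bounded on each generator. -/
structure RepFamily (G : Type u) where
  ι : Type v
  alg : ι → Type w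
  [cstar : ∀ i, NonUnitalCStarAlgebra (alg i)]
  gen : ∀ i, G → alg i
  bdd : ∀ x : G, BddAbove (Set.range fun i => ‖gen i x‖)

namespace RepFamily

attribute [instance] RepFamily.cstar

variable {G : Type u} (F : RepFamily.{u, v, w} G)

/-- A generator, as an element of the C⋆-algebra of bounded families `(bᵢ)`, `bᵢ ∈ alg i`. -/
def genLp (x : G) : lp F.alg ∞ := ⟨fun i => F.gen i x, memℓp_infty (F.bdd x)⟩

/-- The C⋆-subalgebra generated by the image of `G` in the bounded product of all `alg i`. -/
def subalgebra : NonUnitalStarSubalgebra ℂ (lp F.alg ∞) :=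
  (NonUnitalStarAlgebra.adjoin ℂ (Set.range F.genLp)).topologicalClosure

/-- Noncommutative `*`-polynomials in the elements of `G`. -/
inductive Poly (G : Type u) : Type u
  | gen (x : G) : Poly G
  | zero : Poly G
  | add (p q : Poly G) : Poly G
  | mul (p q : Poly G) : Poly G
  | smul (c : ℂ) (p : Poly G) : Poly G
  | star (p : Poly G) : Poly G

/-- Evaluation of a `*`-polynomial in the bounded product. -/
def evalLp : Poly G → lp F.alg ∞
  | .gen x => F.genLp x
  | .zero => 0
  | .add p q => evalLp p + evalLp q
  | .mul p q => evalLp p * evalLp q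
  | .smul c p => c • evalLp p
  | .star p => Star.star (evalLp p)

theorem adjoin_subset_range_evalLp :
    (NonUnitalStarAlgebra.adjoin ℂ (Set.range F.genLp) : Set (lp F.alg ∞)) ⊆
      Set.range F.evalLp := by
  let S : NonUnitalStarSubalgebra ℂ (lp F.alg ∞) :=
    { carrier := Set.range F.evalLp
      add_mem' := by rintro _ _ ⟨p, rfl⟩ ⟨q, rfl⟩; exact ⟨.add p q, rfl⟩
      zero_mem' := ⟨.zero, rfl⟩
      mul_mem' := by rintro _ _ ⟨p, rfl⟩ ⟨q, rfl⟩; exact ⟨.mul p q, rfl⟩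
      smul_mem' := by rintro c _ ⟨p, rfl⟩; exact ⟨.smul c p, rfl⟩
      star_mem' := by rintro _ ⟨p, rfl⟩; exact ⟨.star p, rfl⟩ }
  have : NonUnitalStarAlgebra.adjoin ℂ (Set.range F.genLp) ≤ S := by
    refine NonUnitalStarAlgebra.adjoin_le ?_
    rintro _ ⟨x, rfl⟩
    exact ⟨.gen x, rfl⟩
  exact this

instance small_subalgebra : Small.{u} F.subalgebra := by
  have h : (F.subalgebra : Set (lp F.alg ∞)) ⊆
      Set.range fun s : ℕ → Poly G => limUnder atTop fun n => F.evalLp (s n) := by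
    intro b hb
    obtain ⟨t, ht, hlim⟩ := mem_closure_iff_seq_limit.1 hb
    choose s hs using fun n => F.adjoin_subset_range_evalLp (ht n)
    refine ⟨s, ?_⟩
    simp only [hs]
    exact hlim.limUnder_eq
  exact small_subset h

/-- The universal C⋆-algebra of the family: the C⋆-algebra generated by the image of `G` in the
bounded product, replaced by an isomorphic copy in the universe of `G`. -/
def Universal : Type u := Shrink.{u} F.subalgebra

/-- The identification of the universal C⋆-algebra with the subalgebra of the product. -/
def equiv : F.Universal ≃ F.subalgebra := (equivShrink F.subalgebra).symm

instance : NonUnitalNormedRing F.Universal :=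
  letI : NonUnitalRing F.Universal := F.equiv.nonUnitalRing
  NonUnitalNormedRing.induced F.Universal F.subalgebra F.equiv.ringEquiv F.equiv.injective

instance : Module ℂ F.Universal := F.equiv.module ℂ

instance : Star F.Universal := ⟨fun a => F.equiv.symm (star (F.equiv a))⟩

theorem equiv_add (a b : F.Universal) : F.equiv (a + b) = F.equiv a + F.equiv b := 
  F.equiv.apply_symm_apply _

theorem equiv_mul (a b : F.Universal) : F.equiv (a * b) = F.equiv a * F.equiv b :=
  F.equiv.apply_symm_apply _

theorem equiv_smul (c : ℂ) (a : F.Universal) : F.equiv (c • a) = c • F.equiv a :=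
  F.equiv.apply_symm_apply _

theorem equiv_star (a : F.Universal) : F.equiv (star a) = star (F.equiv a) :=
  F.equiv.apply_symm_apply _

theorem norm_equiv (a : F.Universal) : ‖F.equiv a‖ = ‖a‖ := rfl

instance : NonUnitalCStarAlgebra F.Universal where
  star_involutive a := F.equiv.injective <| by simp [equiv_star]
  star_mul a b := F.equiv.injective <| by simp [equiv_star, equiv_mul]
  star_add a b := F.equiv.injective <| by simp [equiv_star, equiv_add]
  complete {f} hf := by
    have h : CompleteSpace F.subalgebra :=
      (NonUnitalStarSubalgebra.isClosed_topologicalClosure _).completeSpace_coe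
    have e : F.Universal ≃ᵢ F.subalgebra :=
      IsometryEquiv.mk' F.equiv F.equiv.symm (fun x => F.equiv.apply_symm_apply x)
        (Isometry.of_dist_eq fun _ _ => rfl)
    exact e.completeSpace.complete hf
  norm_mul_self_le a := by
    rw [← norm_equiv, ← norm_equiv, equiv_mul, equiv_star]
    exact (CStarRing.norm_star_mul_self (x := (F.equiv a : lp F.alg ∞))).ge
  norm_smul_le c a := by
    rw [← norm_equiv, equiv_smul, ← norm_equiv]; exact norm_smul_le c (F.equiv a)
  smul_assoc c a b := F.equiv.injective <| by
    rw [smul_eq_mul, smul_eq_mul, equiv_mul, equiv_smul, equiv_smul, equiv_mul, smul_mul_assoc]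
  smul_comm c a b := F.equiv.injective <| by
    simp [equiv_smul, equiv_mul, mul_smul_comm]
  star_smul c a := F.equiv.injective <| by simp [equiv_smul, equiv_star]

/-- The image of a generator in the universal C⋆-algebra. -/
def univGen (x : G) : F.Universal :=
  F.equiv.symm ⟨F.genLp x, NonUnitalStarSubalgebra.le_topologicalClosure _
    (NonUnitalStarAlgebra.subset_adjoin ℂ _ ⟨x, rfl⟩)⟩

end RepFamily

/-! ### Relative Cuntz–Pimsner algebras -/

section CuntzPimsner

open HilbertModule

variable (A : Type u) (X : Type u) [NonUnitalCStarAlgebra A] [PartialOrder A]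
  [StarOrderedRing A] [NormedAddCommGroup X] [NormedSpace ℂ X] [CompleteSpace X]
  [HilbertBimodule A X]

/-- A Toeplitz representation `(ψ, π)` of `X` in a C⋆-algebra that is coisometric on an ideal `K`
contained in `J(X)`, that is, `(ψ, π)⁽¹⁾(φ(a)) = π(a)` for all `a ∈ K`. -/
structure CoisometricRep (K : TwoSidedIdeal A) (hK : K ≤ JIdeal A X) where
  B : Type u
  [cstar : NonUnitalCStarAlgebra B]
  ψ : X →ₗ[ℂ] B
  π : A →⋆ₙₐ[ℂ] B
  toeplitz : IsToeplitzRep ψ π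
  coisometric : ∀ (a : A) (ha : a ∈ K),
    onePart toeplitz ⟨HilbertBimodule.φ a, (mem_JIdeal A X a).1 (hK ha)⟩ = π a

attribute [instance] CoisometricRep.cstar

/-- The family of all Toeplitz representations of `X` that are coisometric on `K`. -/
def coisometricFamily (K : TwoSidedIdeal A) (hK : K ≤ JIdeal A X) :
    RepFamily.{u, u + 1, u} (X ⊕ A) where
  ι := CoisometricRep A X K hK
  alg r := r.B
  gen r := Sum.elim r.ψ r.π
  bdd
    | .inl x => ⟨‖x‖, by rintro _ ⟨r, rfl⟩; exact r.toeplitz.norm_le x⟩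
    | .inr a => ⟨‖a‖, by rintro _ ⟨r, rfl⟩; exact NonUnitalStarAlgHom.norm_apply_le r.π a⟩

/-- The relative Cuntz–Pimsner algebra `𝓞(K, X)`: the C⋆-algebra generated by a Toeplitz
representation of `X` that is universal among those that are coisometric on `K`. -/
def RelCuntzPimsner (K : TwoSidedIdeal A) (hK : K ≤ JIdeal A X) : Type u :=
  (coisometricFamily A X K hK).Universal

instance (K : TwoSidedIdeal A) (hK : K ≤ JIdeal A X) :
    NonUnitalCStarAlgebra (RelCuntzPimsner A X K hK) :=
  inferInstanceAs (NonUnitalCStarAlgebra (coisometricFamily A X K hK).Universal)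

namespace RelCuntzPimsner

variable {A X} (K : TwoSidedIdeal A) (hK : K ≤ JIdeal A X)

/-- The canonical map `k_X : X → 𝓞(K, X)`. -/
def kX (x : X) : RelCuntzPimsner A X K hK := (coisometricFamily A X K hK).univGen (.inl x)

/-- The canonical map `k_A : A → 𝓞(K, X)`. -/
def kA (a : A) : RelCuntzPimsner A X K hK := (coisometricFamily A X K hK).univGen (.inr a)

end RelCuntzPimsner

/-- The Cuntz–Pimsner algebra `𝓞(X) = 𝓞(J(X), X)`. -/
abbrev CuntzPimsner : Type u := RelCuntzPimsner A X (JIdeal A X) le_rfl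

end CuntzPimsner

/-! ### Quotients of C⋆-algebras -/

section Quotient

variable {R : Type u} [CStarAlgebra R]

theorem exists_approx_one (I : Ideal R) [I.IsTwoSided] {y : R} (hy : y ∈ I) {δ : ℝ} (hδ : 0 < δ) :
    ∃ u : R, star u = u ∧ ‖u‖ ≤ 1 ∧ 1 - u ∈ I ∧ ‖y * u‖ ≤ δ := by
  set b : R := star y * y with hb
  have hsa : IsSelfAdjoint b := IsSelfAdjoint.star_mul_self y
  have hspec : ∀ t ∈ spectrum ℝ b, 0 ≤ t := fun t ht => spectrum_star_mul_self_nonneg t ht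
  set ε : ℝ := δ ^ 2 with hε'
  have hε : 0 < ε := by positivity
  have hne : ∀ t ∈ spectrum ℝ b, t + ε ≠ 0 := fun t ht => by
    have := hspec t ht; positivity
  have hc : ContinuousOn (fun t : ℝ => (t + ε)⁻¹) (spectrum ℝ b) :=
    ContinuousOn.inv₀ (by fun_prop) hne
  have hc1 : ContinuousOn (fun t : ℝ => ε * (t + ε)⁻¹) (spectrum ℝ b) := continuousOn_const.mul hc
  set u : R := cfc (fun t : ℝ => ε * (t + ε)⁻¹) b with hu
  have husa : star u = u := (cfc_predicate (fun t : ℝ => ε * (t + ε)⁻¹) b : IsSelfAdjoint u)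
  refine ⟨u, husa, ?_, ?_, ?_⟩
  · refine norm_cfc_le zero_le_one fun t ht => ?_
    have := hspec t ht
    rw [Real.norm_of_nonneg (by positivity), ← div_eq_mul_inv, div_le_one (by positivity)]
    linarith
  · have h1 : 1 - u = cfc (fun t : ℝ => (t + ε)⁻¹) b * b := by
      have e1 : (1 : R) = cfc (fun _ : ℝ => (1 : ℝ)) b := (cfc_const_one ℝ b).symm
      have e2 : cfc (fun t : ℝ => (t + ε)⁻¹) b * b =
          cfc (fun t : ℝ => (t + ε)⁻¹ * t) b := by
        nth_rewrite 2 [← cfc_id' ℝ b]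
        rw [← cfc_mul _ _ b hc (by fun_prop)]
      rw [e1, hu, e2, ← cfc_sub _ _ b (by fun_prop) hc1]
      refine cfc_congr fun t ht => ?_
      have := hne t ht
      field_simp
      ring
    rw [h1, hb]
    exact I.mul_mem_left _ (I.mul_mem_left _ hy)
  · refine le_of_sq_le_sq ?_ hδ.le
    rw [pow_two, ← CStarRing.norm_star_mul_self, star_mul, husa]
    have h2 : u * star y * (y * u) = cfc (fun t : ℝ => (ε * (t + ε)⁻¹) * (t * (ε * (t + ε)⁻¹))) b := by
      rw [cfc_mul (fun t : ℝ => ε * (t + ε)⁻¹) (fun t => t * (ε * (t + ε)⁻¹)) b hc1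
          (ContinuousOn.mul continuousOn_id hc1),
        cfc_mul (fun t : ℝ => t) (fun t => ε * (t + ε)⁻¹) b (by fun_prop) hc1,
        cfc_id' ℝ b, ← hu, hb]
      simp only [mul_assoc]
    rw [h2]
    refine norm_cfc_le hε.le fun t ht => ?_
    have := hspec t ht
    rw [Real.norm_of_nonneg (by positivity)]
    have h3 : ε * (t + ε)⁻¹ ≤ 1 := by
      rw [← div_eq_mul_inv, div_le_one (by positivity)]; linarith
    have h4 : t * (ε * (t + ε)⁻¹) ≤ ε := by
      rw [← div_eq_mul_inv, mul_div_assoc', div_le_iff₀ (by positivity)]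
      nlinarith
    calc _ ≤ 1 * ε := by gcongr
      _ = ε := one_mul ε

/-- Closed two-sided ideals of C⋆-algebras are self-adjoint. -/
theorem star_mem_of_closed (I : Ideal R) [I.IsTwoSided] (hI : IsClosed (I : Set R)) {y : R}
    (hy : y ∈ I) : star y ∈ I := by
  have : star y ∈ closure (I : Set R) := by
    rw [Metric.mem_closure_iff]
    intro δ hδ
    obtain ⟨u, h1, -, h3, h4⟩ := exists_approx_one I hy (half_pos hδ)
    refine ⟨(1 - u) * star y, I.mul_mem_right _ h3, ?_⟩
    rw [dist_eq_norm, sub_mul, one_mul, sub_sub_cancel, ← h1, ← star_mul, norm_star]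
    linarith
  rwa [hI.closure_eq] at this

/-- The quotient of a C⋆-algebra by a closed two-sided ideal, with the quotient norm. -/
@[reducible]
def quotientCStarAlgebra (I : Ideal R) [I.IsTwoSided] [hI : IsClosed (I : Set R)] :
    CStarAlgebra (R ⧸ I) :=
  letI : NormedRing (R ⧸ I) :=
    { Submodule.Quotient.normedAddCommGroup I, Ideal.Quotient.ring I with
      norm_mul_le := fun x y => by
        have h : ∀ ε : ℝ, 0 < ε → ‖x * y‖ ≤ (‖x‖ + ε) * (‖y‖ + ε) := by
          intro ε hε
          obtain ⟨a, rfl, ha⟩ := Submodule.Quotient.norm_mk_lt x hε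
          obtain ⟨b, rfl, hb⟩ := Submodule.Quotient.norm_mk_lt y hε
          refine (Submodule.Quotient.norm_mk_le (S := I) (a * b)).trans ?_
          exact (norm_mul_le a b).trans (by gcongr)
        have hc : Tendsto (fun ε : ℝ => (‖x‖ + ε) * (‖y‖ + ε)) (𝓝[>] 0)
            (𝓝 ((‖x‖ + 0) * (‖y‖ + 0))) :=
          (Continuous.tendsto (by fun_prop) 0).mono_left nhdsWithin_le_nhds
        rw [add_zero, add_zero] at hc
        exact ge_of_tendsto hc (eventually_nhdsWithin_of_forall h) }
  letI : StarRing (R ⧸ I) :=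
    { star := Quotient.map' star fun x y h => by
        rw [Submodule.quotientRel_def] at h ⊢
        rw [← star_sub]
        exact star_mem_of_closed I hI h
      star_involutive := by rintro ⟨x⟩; exact congrArg (Ideal.Quotient.mk I) (star_star x)
      star_mul := by rintro ⟨x⟩ ⟨y⟩; exact congrArg (Ideal.Quotient.mk I) (star_mul x y)
      star_add := by rintro ⟨x⟩ ⟨y⟩; exact congrArg (Ideal.Quotient.mk I) (star_add x y) }
  { Submodule.Quotient.normedSpace I ℂ, Ideal.Quotient.algebra ℂ with
    complete := (Submodule.Quotient.completeSpace I).complete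
    norm_mul_self_le := by
      rintro ⟨a⟩
      refine le_of_forall_pos_le_add fun η hη => ?_
      obtain ⟨z, hz, hzn⟩ := Submodule.Quotient.norm_mk_lt
        (Submodule.Quotient.mk (p := I) (star a * a)) (half_pos hη)
      have hy : z - star a * a ∈ I := (Submodule.Quotient.eq I).1 hz
      obtain ⟨u, h1, h2, h3, h4⟩ := exists_approx_one I hy (half_pos hη)
      have e1 : Submodule.Quotient.mk (p := I) a = Submodule.Quotient.mk (a * u) := by
        rw [Submodule.Quotient.eq]
        have := I.mul_mem_left a h3
        rwa [mul_sub, mul_one] at this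
      have e2 : ‖Submodule.Quotient.mk (p := I) a‖ ≤ ‖a * u‖ := by
        rw [e1]; exact Submodule.Quotient.norm_mk_le (S := I) _
      have e3 : ‖a * u‖ * ‖a * u‖ ≤ ‖z‖ + η / 2 := by
        rw [← CStarRing.norm_star_mul_self, star_mul, h1]
        have e4 : u * star a * (a * u) = u * z * u - u * ((z - star a * a) * u) := by
          noncomm_ring
        rw [e4]
        refine (norm_sub_le _ _).trans ?_
        gcongr
        · calc ‖u * z * u‖ ≤ ‖u‖ * ‖z‖ * ‖u‖ :=
                (norm_mul_le _ _).trans (by gcongr; exact norm_mul_le _ _)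
            _ ≤ 1 * ‖z‖ * 1 := by gcongr
            _ = ‖z‖ := by ring
        · calc ‖u * ((z - star a * a) * u)‖ ≤ ‖u‖ * ‖(z - star a * a) * u‖ := norm_mul_le _ _
            _ ≤ 1 * (η / 2) := by gcongr
            _ = η / 2 := one_mul _
      calc ‖Submodule.Quotient.mk (p := I) a‖ * ‖Submodule.Quotient.mk (p := I) a‖
          ≤ ‖a * u‖ * ‖a * u‖ := by gcongr
        _ ≤ ‖z‖ + η / 2 := e3
        _ ≤ ‖Submodule.Quotient.mk (p := I) (star a * a)‖ + η / 2 + η / 2 := by gcongr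
        _ = ‖Submodule.Quotient.mk (p := I) (star a * a)‖ + η := by ring
    star_smul := by rintro c ⟨x⟩; exact congrArg (Ideal.Quotient.mk I) (star_smul c x) }

end Quotient

/-! ### Transfer operators and the bimodule `M_L` -/

section Exel

variable {A : Type u} [CStarAlgebra A] [PartialOrder A] [StarOrderedRing A]

/-- A transfer operator for `(A, α)`. -/
structure TransferOperator (α : A →⋆ₙₐ[ℂ] A) where
  toCLM : A →L[ℂ] A
  nonneg (a : A) : 0 ≤ a → 0 ≤ toCLM a
  transfer (a b : A) : toCLM (α a * b) = a * toCLM b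

namespace TransferOperator

variable {α : A →⋆ₙₐ[ℂ] A}

instance : CoeFun (TransferOperator α) fun _ => A → A := ⟨fun L => L.toCLM⟩

variable (L : TransferOperator α)

theorem map_star (a : A) : L (star a) = star (L a) := by
  have hm : ∀ x y : A, x ≤ y → L x ≤ L y := fun x y h => by
    have := L.nonneg (y - x) (sub_nonneg.2 h)
    rwa [map_sub, sub_nonneg] at this
  exact StarHomClass.map_star (PositiveLinearMap.mk L.toCLM.toLinearMap hm) a

theorem transfer_right (a b : A) : L (b * α a) = L b * a := by
  have := congrArg star (L.transfer (star a) (star b))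
  rwa [← map_star, star_mul, StarHomClass.map_star, star_star, star_star, star_mul, map_star,
    star_star, star_star] at this


/-- The copy `A_L` of the vector space `A`. -/
def AL (_L : TransferOperator α) : Type u := A

instance : AddCommGroup L.AL := inferInstanceAs (AddCommGroup A)

instance : Module ℂ L.AL := inferInstanceAs (Module ℂ A)

/-- The identity map `A → A_L`. -/
def toAL : A ≃ₗ[ℂ] L.AL := LinearEquiv.refl ℂ A

/-- The identity map `A_L → A`. -/
def ofAL : L.AL ≃ₗ[ℂ] A := LinearEquiv.refl ℂ A

/-- The right action `m · a = m α(a)` and the inner product `⟪m, n⟫_L = L(m⋆ n)` on `A_L`. -/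
instance : PreHilbertModule A L.AL where
  ip m n := L (star (L.ofAL m) * L.ofAL n)
  act m a := L.toAL (L.ofAL m * α a)
  add_act x y a := by rw [map_add, add_mul, map_add]
  act_add x a b := by rw [map_add, mul_add, map_add]
  act_mul x a b := by rw [map_mul α a b, ← mul_assoc]; rfl
  smul_act c x a := by rw [map_smul, smul_mul_assoc, map_smul]
  act_smul c x a := by rw [map_smul, mul_smul_comm, map_smul]
  ip_add_right x y z := by rw [map_add, mul_add, map_add]
  ip_smul_right c x y := by rw [map_smul, mul_smul_comm, map_smul]
  ip_act_right x y a := by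
    change L (star (L.ofAL x) * (L.ofAL y * α a)) = _
    rw [← mul_assoc, L.transfer_right]
  star_ip x y := by rw [← L.map_star, star_mul, star_star]
  ip_self_nonneg x := L.nonneg _ (star_mul_self_nonneg _)

open PreHilbertModule

theorem ip_AL (m n : L.AL) : ip (A := A) m n = L (star (L.ofAL m) * L.ofAL n) := rfl

/-- The seminorm `‖m‖ = ‖⟪m, m⟫_L‖ ^ (1 / 2)` on `A_L`. -/
instance : Norm L.AL := ⟨fun m => √‖ip (A := A) m m‖⟩

instance : SeminormedAddCommGroup L.AL := SeminormedAddCommGroup.ofCore (seminormCore A L.AL)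

theorem norm_sq_AL (m : L.AL) : ‖m‖ ^ 2 = ‖ip (A := A) m m‖ := Real.sq_sqrt (norm_nonneg _)

instance : NormedSpace ℂ L.AL where
  norm_smul_le c x := ((seminormCore A L.AL).norm_smul c x).le

/-- The right action of `a` on `A_L`. -/
def rightAL (a : A) : L.AL →L[ℂ] L.AL :=
  LinearMap.mkContinuous
    { toFun := fun m => act m a
      map_add' := fun x y => add_act x y a
      map_smul' := fun c x => smul_act c x a } ‖a‖ fun m => by
    refine le_of_sq_le_sq ?_ (by positivity)
    change ‖act m a‖ ^ 2 ≤ _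
    rw [norm_sq_AL, ip_act_left, ip_act_right, mul_pow, norm_sq_AL]
    calc _ ≤ ‖star a‖ * (‖ip (A := A) m m‖ * ‖a‖) :=
          (norm_mul_le _ _).trans (by gcongr; exact norm_mul_le _ _)
      _ = _ := by rw [norm_star]; ring

/-- Left multiplication by `a` on `A_L`. -/
def leftAL (a : A) : L.AL →L[ℂ] L.AL :=
  LinearMap.mkContinuous
    { toFun := fun m => L.toAL (a * L.ofAL m)
      map_add' := fun x y => by rw [map_add, mul_add, map_add]
      map_smul' := fun c x => by rw [map_smul, mul_smul_comm, map_smul]; rfl } ‖a‖ fun m => by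
    refine le_of_sq_le_sq ?_ (by positivity)
    change ‖L.toAL (a * L.ofAL m)‖ ^ 2 ≤ _
    rw [norm_sq_AL, mul_pow, norm_sq_AL, ip_AL, ip_AL]
    change ‖L (star (a * L.ofAL m) * (a * L.ofAL m))‖ ≤ _
    set n := L.ofAL m
    have h1 : star (a * n) * (a * n) ≤ (‖a‖ ^ 2) • (star n * n) := by
      have := CStarAlgebra.star_left_conjugate_le_norm_smul (a := n) (b := star a * a)
        (hb := IsSelfAdjoint.star_mul_self a)
      rw [CStarRing.norm_star_mul_self, ← pow_two] at this
      rw [star_mul]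
      simpa only [mul_assoc] using this
    have h2 : L (star (a * n) * (a * n)) ≤ (‖a‖ ^ 2) • L (star n * n) := by
      have := L.nonneg _ (sub_nonneg.2 h1)
      rw [map_sub, sub_nonneg] at this
      refine this.trans_eq ?_
      rw [← Complex.coe_smul, map_smul, Complex.coe_smul]
    have h3 := CStarAlgebra.norm_le_norm_of_nonneg_of_le
      (L.nonneg _ (star_mul_self_nonneg _)) h2
    rwa [norm_smul, Real.norm_of_nonneg (by positivity)] at h3

/-- The completion `M_L` of `A_L / N`, where `N = {m | ⟪m, m⟫_L = 0}`: the Hausdorff completion of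
`A_L`, which identifies two vectors of `A_L` exactly if their difference has norm `0`. -/
def M (L : TransferOperator α) : Type u := UniformSpace.Completion L.AL

instance : NormedAddCommGroup L.M := inferInstanceAs (NormedAddCommGroup (UniformSpace.Completion L.AL))

instance : NormedSpace ℂ L.M := inferInstanceAs (NormedSpace ℂ (UniformSpace.Completion L.AL))

instance : CompleteSpace L.M := inferInstanceAs (CompleteSpace (UniformSpace.Completion L.AL))

/-- The canonical map `A_L → M_L`. -/
def qAL : L.AL →L[ℂ] L.M := UniformSpace.Completion.toComplL

/-- The map `q : A → M_L`. -/
def q (a : A) : L.M := L.qAL (L.toAL a)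

theorem isUniformInducing_qAL : IsUniformInducing L.qAL :=
  UniformSpace.Completion.isUniformInducing_coe _

theorem denseRange_qAL : DenseRange L.qAL := UniformSpace.Completion.denseRange_coe

theorem isDenseInducing_qAL : IsDenseInducing L.qAL := UniformSpace.Completion.isDenseInducing_coe

theorem norm_qAL (m : L.AL) : ‖L.qAL m‖ = ‖m‖ := UniformSpace.Completion.norm_coe m

/-- The extension to `M_L` of a bounded operator on `A_L`. -/
def extendM (T : L.AL →L[ℂ] L.AL) : L.M →L[ℂ] L.M := (L.qAL.comp T).extend L.qAL

theorem extendM_qAL (T : L.AL →L[ℂ] L.AL) (m : L.AL) : L.extendM T (L.qAL m) = L.qAL (T m) :=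
  ContinuousLinearMap.extend_eq _ L.denseRange_qAL L.isUniformInducing_qAL m

/-- The extension to `M_L` of the inner product of `A_L`. -/
def ipM (x y : L.M) : A :=
  (L.isDenseInducing_qAL.prodMap L.isDenseInducing_qAL).extend
    (fun p : L.AL × L.AL => ip (A := A) p.1 p.2) (x, y)

theorem continuous_ip_AL : Continuous fun p : L.AL × L.AL => ip (A := A) p.1 p.2 := by
  let f : L.AL →ₗ⋆[ℂ] L.AL →ₗ[ℂ] A :=
    LinearMap.mk₂'ₛₗ (starRingEnd ℂ) (RingHom.id ℂ) (fun m n => ip (A := A) m n)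
      (fun x y z => ip_add_left x y z) (fun c x y => ip_smul_left c x y)
      (fun x y z => ip_add_right x y z) (fun c x y => ip_smul_right c x y)
  let g := f.mkContinuous₂ 1 fun x y => by
    rw [one_mul]; exact norm_ip_le (A := A) x y
  have : Continuous fun p : L.AL × L.AL => g p.1 p.2 := by fun_prop
  exact this

theorem ipM_qAL (m n : L.AL) : L.ipM (L.qAL m) (L.qAL n) = ip (A := A) m n :=
  (L.isDenseInducing_qAL.prodMap L.isDenseInducing_qAL).extend_eq L.continuous_ip_AL (m, n)

theorem continuous_ipM : Continuous fun p : L.M × L.M => L.ipM p.1 p.2 := by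
  let f : L.AL →+ L.AL →+ A := AddMonoidHom.mk'
    (fun m => AddMonoidHom.mk' (fun n => ip (A := A) m n) fun x y => ip_add_right m x y)
    fun x y => by ext z; exact ip_add_left x y z
  exact IsDenseInducing.extend_Z_bilin (φ := f) (e := L.qAL.toLinearMap.toAddMonoidHom)
    (f := L.qAL.toLinearMap.toAddMonoidHom) L.isDenseInducing_qAL L.isDenseInducing_qAL
    L.continuous_ip_AL

@[fun_prop]
theorem continuous_ipM' {Y : Type*} [TopologicalSpace Y] {f g : Y → L.M} (hf : Continuous f)
    (hg : Continuous g) : Continuous fun y => L.ipM (f y) (g y) :=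
  L.continuous_ipM.comp (hf.prodMk hg)

variable {L} in
@[elab_as_elim]
theorem M_induction {p : L.M → Prop} (x : L.M) (hp : IsClosed {x | p x})
    (h : ∀ m : L.AL, p (L.qAL m)) : p x :=
  L.denseRange_qAL.induction_on x hp h

theorem extendM_add (S T : L.AL →L[ℂ] L.AL) :
    L.extendM (S + T) = L.extendM S + L.extendM T := by
  ext x
  refine M_induction x ?_ fun m => ?_
  · exact isClosed_eq (by fun_prop) (by fun_prop)
  simp [extendM_qAL]

theorem extendM_smul (c : ℂ) (T : L.AL →L[ℂ] L.AL) :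
    L.extendM (c • T) = c • L.extendM T := by
  ext x
  rw [_root_.smul_apply]
  refine M_induction x ?_ fun m => ?_
  · exact isClosed_eq (L.extendM (c • T)).continuous ((L.extendM T).continuous.const_smul c)
  rw [extendM_qAL, extendM_qAL, _root_.smul_apply, map_smul]

theorem extendM_comp (S T : L.AL →L[ℂ] L.AL) :
    L.extendM (S.comp T) = (L.extendM S).comp (L.extendM T) := by
  ext x
  refine M_induction x ?_ fun m => ?_
  · exact isClosed_eq (by fun_prop) (by fun_prop)
  simp [extendM_qAL]

theorem rightAL_apply (a : A) (m : L.AL) : L.rightAL a m = act m a := rfl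

theorem leftAL_apply (a : A) (m : L.AL) : L.leftAL a m = L.toAL (a * L.ofAL m) := rfl

/-- `M_L` as a Hilbert bimodule over `A`, with `⟪q(a), q(b)⟫ = L(a⋆ b)`, `q(a) · b = q(a α(b))`
and `φ(a) q(b) = q(a b)`. -/
instance : HilbertBimodule A L.M where
  ip := L.ipM
  act x a := L.extendM (L.rightAL a) x
  add_act x y a := map_add _ x y
  act_add x a b := by
    rw [show L.rightAL (a + b) = L.rightAL a + L.rightAL b from
      ContinuousLinearMap.ext fun m => act_add m a b, extendM_add]
    rfl
  act_mul x a b := by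
    rw [show L.rightAL (a * b) = (L.rightAL b).comp (L.rightAL a) from
      ContinuousLinearMap.ext fun m => act_mul m a b, extendM_comp]
    rfl
  smul_act c x a := map_smul _ c x
  act_smul c x a := by
    rw [show L.rightAL (c • a) = c • L.rightAL a from
      ContinuousLinearMap.ext fun m => act_smul c m a, extendM_smul]
    rfl
  ip_add_right x y z := by
    refine M_induction x ?_ fun x => ?_
    · exact isClosed_eq (by fun_prop) (by fun_prop)
    refine M_induction y ?_ fun y => ?_
    · exact isClosed_eq (by fun_prop) (by fun_prop)
    refine M_induction z ?_ fun z => ?_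
    · exact isClosed_eq (by fun_prop) (by fun_prop)
    rw [← map_add, ipM_qAL, ipM_qAL, ipM_qAL, ip_add_right]
  ip_smul_right c x y := by
    have h : Continuous fun y : L.M => c • y := continuous_const_smul c
    refine M_induction x ?_ fun x => ?_
    · exact isClosed_eq (L.continuous_ipM' continuous_id continuous_const)
        ((L.continuous_ipM' continuous_id continuous_const).const_smul c)
    refine M_induction y ?_ fun y => ?_
    · exact isClosed_eq (L.continuous_ipM' continuous_const h)
        ((L.continuous_ipM' continuous_const continuous_id).const_smul c)
    rw [← map_smul, ipM_qAL, ipM_qAL, ip_smul_right]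
  ip_act_right x y a := by
    refine M_induction x ?_ fun x => ?_
    · exact isClosed_eq (by fun_prop) (by fun_prop)
    refine M_induction y ?_ fun y => ?_
    · exact isClosed_eq (by fun_prop) (by fun_prop)
    rw [extendM_qAL, ipM_qAL, ipM_qAL, rightAL_apply, ip_act_right]
  star_ip x y := by
    refine M_induction x ?_ fun x => ?_
    · exact isClosed_eq (by fun_prop) (by fun_prop)
    refine M_induction y ?_ fun y => ?_
    · exact isClosed_eq (by fun_prop) (by fun_prop)
    rw [ipM_qAL, ipM_qAL, star_ip]
  ip_self_nonneg x := by
    refine M_induction x ?_ fun x => ?_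
    · exact isClosed_le (by fun_prop) (by fun_prop)
    rw [ipM_qAL]
    exact ip_self_nonneg x
  norm_sq_eq x := by
    refine M_induction x ?_ fun x => ?_
    · exact isClosed_eq (by fun_prop) (by fun_prop)
    rw [ipM_qAL, norm_qAL, norm_sq_AL]
  φ :=
    { toFun := fun a => L.extendM (L.leftAL a)
      map_smul' := fun c a => by
        rw [← extendM_smul]
        congr 1
        ext m
        simp only [leftAL_apply, smul_mul_assoc, map_smul]
        rfl
      map_zero' := by
        ext x
        refine M_induction x ?_ fun m => ?_
        · exact isClosed_eq (by fun_prop) (by fun_prop)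
        simp [extendM_qAL, leftAL_apply]
      map_add' := fun a b => by
        rw [← extendM_add]
        congr 1
        ext m
        simp only [leftAL_apply, add_mul, map_add]
        rfl
      map_mul' := fun a b => by
        rw [ContinuousLinearMap.mul_def, ← extendM_comp]
        congr 1
        ext m
        simp only [leftAL_apply, mul_assoc]
        rfl }
  ip_φ_left a x y := by
    change L.ipM (L.extendM (L.leftAL a) x) y = L.ipM x (L.extendM (L.leftAL (star a)) y)
    refine M_induction x ?_ fun x => ?_
    · exact isClosed_eq (by fun_prop) (by fun_prop)
    refine M_induction y ?_ fun y => ?_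
    · exact isClosed_eq (by fun_prop) (by fun_prop)
    rw [extendM_qAL, extendM_qAL, ipM_qAL, ipM_qAL, ip_AL, ip_AL]
    change L (star (a * L.ofAL x) * L.ofAL y) = L (star (L.ofAL x) * (star a * L.ofAL y))
    rw [star_mul, mul_assoc]

theorem ip_q (a b : A) : ip (A := A) (L.q a) (L.q b) = L (star a * b) := L.ipM_qAL _ _

theorem q_act (a b : A) : act (L.q a) b = L.q (a * α b) := L.extendM_qAL _ _

theorem φ_q (a b : A) : HilbertBimodule.φ a (L.q b) = L.q (a * b) := L.extendM_qAL _ _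


/-! ### The Toeplitz algebra of `(A, α, L)` -/

/-- A Toeplitz-covariant representation `(ρ, V)` of `(A, α, L)` in a unital C⋆-algebra `B`. -/
structure ToeplitzCovariantRep where
  B : Type u
  [cstar : CStarAlgebra B]
  ρ : A →⋆ₐ[ℂ] B
  V : B
  tc1 (a : A) : V * ρ a = ρ (α a) * V
  tc2 (a : A) : star V * ρ a * V = ρ (L a)

attribute [instance] ToeplitzCovariantRep.cstar

/-- The family of all Toeplitz-covariant representations. The generator `none` stands for the
element `V`, the generator `some a` for the image of `a : A`. -/
def toeplitzFamily : RepFamily.{u, u + 1, u} (Option A) where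
  ι := ToeplitzCovariantRep L
  alg r := r.B
  gen r x := x.elim r.V r.ρ
  bdd
    | none => ⟨√‖L 1‖, by
        rintro _ ⟨r, rfl⟩
        refine Real.le_sqrt_of_sq_le ?_
        change ‖r.V‖ ^ 2 ≤ _
        rw [pow_two, ← CStarRing.norm_star_mul_self, ← mul_one (star r.V), ← map_one r.ρ, r.tc2]
        exact NonUnitalStarAlgHom.norm_apply_le r.ρ _⟩
    | some a => ⟨‖a‖, by rintro _ ⟨r, rfl⟩; exact NonUnitalStarAlgHom.norm_apply_le r.ρ a⟩

/-- The algebra `𝓣(A, α, L)`: the unital C⋆-algebra generated by a Toeplitz-covariant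
representation of `(A, α, L)` that is universal among all of them. -/
def ToeplitzAlgebra : Type u := L.toeplitzFamily.Universal

instance : NonUnitalCStarAlgebra L.ToeplitzAlgebra :=
  inferInstanceAs (NonUnitalCStarAlgebra L.toeplitzFamily.Universal)

/-- The canonical map `i_A : A → 𝓣(A, α, L)`. -/
def iA (a : A) : L.ToeplitzAlgebra := L.toeplitzFamily.univGen (some a)

/-- The canonical element `S` of `𝓣(A, α, L)`. -/
def S : L.ToeplitzAlgebra := L.toeplitzFamily.univGen none

theorem iA_one_mul (x : L.ToeplitzAlgebra) : L.iA 1 * x = x := by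
  refine L.toeplitzFamily.equiv.injective (Subtype.ext (lp.ext (funext fun r => ?_)))
  have h := congrArg (fun z : L.toeplitzFamily.subalgebra =>
    (z : lp L.toeplitzFamily.alg ∞) r) (L.toeplitzFamily.equiv_mul (L.iA 1) x)
  refine h.trans ?_
  change (L.toeplitzFamily.equiv (L.toeplitzFamily.equiv.symm _)).1 r *
    (L.toeplitzFamily.equiv x).1 r = _
  rw [Equiv.apply_symm_apply]
  have key : ∀ (r : ToeplitzCovariantRep L) (b : r.B), r.ρ 1 * b = b := fun r b => by
    rw [map_one, one_mul]
  exact key r _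

theorem mul_iA_one (x : L.ToeplitzAlgebra) : x * L.iA 1 = x := by
  refine L.toeplitzFamily.equiv.injective (Subtype.ext (lp.ext (funext fun r => ?_)))
  have h := congrArg (fun z : L.toeplitzFamily.subalgebra =>
    (z : lp L.toeplitzFamily.alg ∞) r) (L.toeplitzFamily.equiv_mul x (L.iA 1))
  refine h.trans ?_
  change (L.toeplitzFamily.equiv x).1 r *
    (L.toeplitzFamily.equiv (L.toeplitzFamily.equiv.symm _)).1 r = _
  rw [Equiv.apply_symm_apply]
  have key : ∀ (r : ToeplitzCovariantRep L) (b : r.B), b * r.ρ 1 = b := fun r b => by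
    rw [map_one, mul_one]
  exact key r _

/-- `𝓣(A, α, L)` is unital, with unit `i_A(1)`. -/
instance : CStarAlgebra L.ToeplitzAlgebra :=
  letI : Ring L.ToeplitzAlgebra :=
    { (inferInstance : NonUnitalRing L.ToeplitzAlgebra) with
      one := L.iA 1
      one_mul := L.iA_one_mul
      mul_one := L.mul_iA_one }
  letI : Algebra ℂ L.ToeplitzAlgebra :=
    Algebra.ofModule (fun c x y => smul_mul_assoc c x y) (fun c x y => mul_smul_comm c x y)
  { (inferInstance : NonUnitalCStarAlgebra L.ToeplitzAlgebra),
    (inferInstance : Ring L.ToeplitzAlgebra), (inferInstance : Algebra ℂ L.ToeplitzAlgebra) with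
    norm_smul_le := fun c x => norm_smul_le c x }

/-! ### Redundancies and the crossed product -/

/-- The closed linear span of `A α(A) A`. -/
def spanAαA (α : A →⋆ₙₐ[ℂ] A) : Submodule ℂ A :=
  (Submodule.span ℂ {x | ∃ a b c : A, x = a * α b * c}).topologicalClosure

/-- `(i_A(a), k)` is a redundancy: `k` is in the closed linear span of `i_A(A) S S⋆ i_A(A)` and
`i_A(a) i_A(b) S = k i_A(b) S` for all `b`. -/
def IsRedundancy (a : A) (k : L.ToeplitzAlgebra) : Prop :=
  k ∈ (Submodule.span ℂ
      {x | ∃ b c : A, x = L.iA b * L.S * star L.S * L.iA c}).topologicalClosure ∧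
    ∀ b : A, L.iA a * L.iA b * L.S = k * L.iA b * L.S

/-- The closed two-sided ideal of `𝓣(A, α, L)` generated by the elements `i_A(a) - k`, where
`(i_A(a), k)` is a redundancy with `a` in the closed linear span of `A α(A) A`. -/
def redundancyIdeal : Ideal L.ToeplitzAlgebra :=
  sInf {I | I.IsTwoSided ∧ IsClosed (I : Set L.ToeplitzAlgebra) ∧
    ∀ (a : A) (k : L.ToeplitzAlgebra), a ∈ spanAαA α → L.IsRedundancy a k → L.iA a - k ∈ I}

instance : L.redundancyIdeal.IsTwoSided where
  mul_mem_of_left b ha := by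
    rw [redundancyIdeal, Submodule.mem_sInf] at *
    intro I hI
    have := hI.1
    exact Ideal.mul_mem_right b I (ha I hI)

instance isClosed_redundancyIdeal : IsClosed (L.redundancyIdeal : Set L.ToeplitzAlgebra) := by
  rw [redundancyIdeal, Submodule.coe_sInf]
  exact isClosed_biInter fun I hI => hI.2.1

/-- Exel's crossed product `A ⋊_{α,L} ℕ`. -/
def CrossedProduct : Type u := L.ToeplitzAlgebra ⧸ L.redundancyIdeal

instance : CStarAlgebra L.CrossedProduct := quotientCStarAlgebra L.redundancyIdeal

/-- The quotient map `Q : 𝓣(A, α, L) → A ⋊_{α,L} ℕ`. -/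
def Q (x : L.ToeplitzAlgebra) : L.CrossedProduct := Ideal.Quotient.mk L.redundancyIdeal x

/-- The canonical map `j_A = Q ∘ i_A`. -/
def jA (a : A) : L.CrossedProduct := L.Q (L.iA a)

/-- The canonical element `T = Q(S)`. -/
def T : L.CrossedProduct := L.Q L.S

theorem mul_mem_spanAαA_left (b : A) {a : A} (ha : a ∈ spanAαA α) : b * a ∈ spanAαA α := by
  have hc : IsClosed ((spanAαA α).comap (LinearMap.mulLeft ℂ b) : Set A) :=
    (Submodule.isClosed_topologicalClosure _).preimage (continuous_const_mul b)
  refine Submodule.topologicalClosure_minimal _ ?_ hc ha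
  rw [Submodule.span_le]
  rintro _ ⟨x, y, z, rfl⟩
  exact Submodule.le_topologicalClosure _
    (Submodule.subset_span ⟨b * x, y, z, by simp [mul_assoc]⟩)

theorem mul_mem_spanAαA_right (b : A) {a : A} (ha : a ∈ spanAαA α) : a * b ∈ spanAαA α := by
  have hc : IsClosed ((spanAαA α).comap (LinearMap.mulRight ℂ b) : Set A) :=
    (Submodule.isClosed_topologicalClosure _).preimage (continuous_mul_const b)
  refine Submodule.topologicalClosure_minimal _ ?_ hc ha
  rw [Submodule.span_le]
  rintro _ ⟨x, y, z, rfl⟩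
  exact Submodule.le_topologicalClosure _
    (Submodule.subset_span ⟨x, y, z * b, by simp [mul_assoc]⟩)

/-- The ideal `K_α`: the intersection of the closed linear span of `A α(A) A` with `J(M_L)`. -/
def Kα : TwoSidedIdeal A :=
  TwoSidedIdeal.mk' {a | a ∈ spanAαA α ∧ a ∈ HilbertModule.JIdeal A L.M}
    ⟨zero_mem _, TwoSidedIdeal.zero_mem _⟩
    (fun ha hb => ⟨add_mem ha.1 hb.1, TwoSidedIdeal.add_mem _ ha.2 hb.2⟩)
    (fun ha => ⟨neg_mem ha.1, TwoSidedIdeal.neg_mem _ ha.2⟩)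
    (fun {a _} hb => ⟨mul_mem_spanAαA_left a hb.1, TwoSidedIdeal.mul_mem_left _ _ _ hb.2⟩)
    (fun {_ b} ha => ⟨mul_mem_spanAαA_right b ha.1, TwoSidedIdeal.mul_mem_right _ _ _ ha.2⟩)

theorem Kα_le : L.Kα ≤ HilbertModule.JIdeal A L.M := fun _ ha =>
  ((TwoSidedIdeal.mem_mk' _ _ _ _ _ _ _).1 ha).2

end TransferOperator

end Exel

end

/-!
The isomorphism rests on a dictionary between two kinds of representations. A pair of a homomorphism
`π` of `A` and an element `V` with `V π(a) = π(α(a)) V` and `V⋆ π(a) V = π(L(a))` gives a Toeplitz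
representation of `M_L` by `q(a) ↦ π(a) V` (`isToeplitzRep_ofCovariant`), and every Toeplitz
representation `(ψ, π)` arises in this way from `V = ψ(q(1))`. Since `q(a α(1)) = q(a)`, the element
`k_A(1)` is a unit of `𝓞(K, M_L)` (`kA_one_unit`) even if `α` is not unital, so that
`(k_A, k_M(q(1)))` is a Toeplitz-covariant representation in a unital C⋆-algebra.

Under this dictionary the redundancies become the coisometry relations: `(i_A(a), k)` is a redundancy
if and only if `φ(a)` is compact and `k = (i_M, i_A)⁽¹⁾(φ(a))` (`isRedundancy_iff`). One direction
is the rule `(ψ, π)⁽¹⁾(T) ψ(x) = ψ(T x)`. For the other one, `i_A` is injective, so that `i_M` is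
isometric, hence `(i_M, i_A)⁽¹⁾` does not decrease norms and has closed range, which is the closed
linear span of `i_A(A) S S⋆ i_A(A)`. Thus `k` is the image of a compact operator `T`, and `T`
agrees with `φ(a)` on each `q(b)`. The universal properties then give homomorphisms in both
directions which are inverse to each other on generators.

The injectivity of `i_A` needs sufficiently many Toeplitz-covariant representations. For a positive
functional `f` of `A`, the tensor power `M_L^{⊗n}` paired with the GNS space of `f` is the GNS space of
`f ∘ Lⁿ`, so the Fock representation lives on the direct sum of the latter spaces. This sum is
obtained in one stroke as the GNS space of the functional `x ↦ ∑ rⁿ f(Lⁿ(xₙ))` on the C⋆-algebra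
of bounded sequences in `A`, where `0 < r` and `r ‖L‖ < 1`: the algebra `A` acts through the constant
sequences and `S` acts as a multiple of `(x₀, x₁, …) ↦ (0, α(x₀), α(x₁), …)`. Positive
functionals separate the points of `A` because the cone of positive elements is closed and convex.
-/

noncomputable section

open scoped CStarAlgebra

/-! ### Positive functionals -/

open scoped ComplexOrder in
/-- Positive functionals separate points. The functional is the complexification of a real
functional which separates `-a⋆a` from the closed convex cone of positive elements. -/
theorem exists_positiveLinearMap_ne_zero {A : Type u} [CStarAlgebra A] [PartialOrder A]
    [StarOrderedRing A] {a : A} (ha : a ≠ 0) : ∃ f : A →ₚ[ℂ] ℂ, f (star a * a) ≠ 0 := by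
  have hmem : -(star a * a) ∉ ProperCone.positive ℝ A := by
    rw [ProperCone.mem_positive, Left.nonneg_neg_iff]
    intro h
    exact ha ((CStarRing.star_mul_self_eq_zero_iff a).1 (le_antisymm h (star_mul_self_nonneg a)))
  obtain ⟨g, hg, hg0⟩ := ProperCone.hyperplane_separation_point _ hmem
  -- `h(x) = g(Re x)`, the real part of the functional to be constructed
  let h : Module.Dual ℝ A := g.toLinearMap ∘ₗ (selfAdjoint.submodule ℝ A).subtype ∘ₗ realPart
  have hh : ∀ x, h x = g (realPart x : A) := fun x => rfl
  have hpos : ∀ x : A, IsSelfAdjoint x →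
      Module.Dual.extendRCLike (𝕜 := ℂ) h x = (g x : ℂ) := by
    intro x hx
    rw [Module.Dual.extendRCLike_apply, hh, hh]
    simp [realPart_I_smul, hx.imaginaryPart, hx.coe_realPart]
  refine ⟨PositiveLinearMap.mk₀ (Module.Dual.extendRCLike (𝕜 := ℂ) h) fun x hx => ?_, ?_⟩
  · rw [hpos x hx.isSelfAdjoint]
    exact_mod_cast hg x hx
  · change Module.Dual.extendRCLike (𝕜 := ℂ) h (star a * a) ≠ 0
    rw [hpos _ (IsSelfAdjoint.star_mul_self a)]
    rw [map_neg] at hg0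
    exact_mod_cast (neg_lt_zero.1 hg0).ne'

/-! ### The Fock representation of a positive functional -/

namespace TransferOperator
section Fock
open scoped ComplexOrder BoundedContinuousFunction
open BoundedContinuousFunction

variable {A : Type u} [CStarAlgebra A] [PartialOrder A] [StarOrderedRing A]

/-- The shift `(x₀, x₁, …) ↦ (0, α(x₀), α(x₁), …)` on bounded sequences. -/
def shift (α : A →⋆ₙₐ[ℂ] A) : (ℕ →ᵇ A) →ₗ[ℂ] (ℕ →ᵇ A) where
  toFun x := ofNormedAddCommGroupDiscrete (fun n => n.casesOn 0 fun n => α (x n)) ‖x‖ (by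
    rintro (_ | n)
    · simp
    · exact (NonUnitalStarAlgHom.norm_apply_le α _).trans (x.norm_coe_le_norm n))
  map_add' x y := by ext (_ | n) <;> simp
  map_smul' c x := by ext (_ | n) <;> simp

theorem shift_zero (α : A →⋆ₙₐ[ℂ] A) (x : ℕ →ᵇ A) : shift α x 0 = 0 := rfl

theorem shift_succ (α : A →⋆ₙₐ[ℂ] A) (x : ℕ →ᵇ A) (n : ℕ) : shift α x (n + 1) = α (x n) := rfl

/-- The embedding of `A` into the bounded sequences as constant sequences. -/
def constSeq : A →⋆ₐ[ℂ] (ℕ →ᵇ A) where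
  toFun a := const ℕ a
  map_one' := rfl
  map_mul' _ _ := rfl
  map_zero' := rfl
  map_add' _ _ := rfl
  commutes' _ := rfl
  map_star' _ := rfl

variable {α : A →⋆ₙₐ[ℂ] A} (L : TransferOperator α) (f : A →ₚ[ℂ] ℂ)

/-- A weight `r > 0` with `r ‖L‖ < 1`. -/
def weight : ℝ := (‖L.toCLM‖ + 1)⁻¹

theorem weight_pos : 0 < L.weight := by unfold weight; positivity

theorem summable_fock (x : ℕ →ᵇ A) :
    Summable fun n => (L.weight : ℂ) ^ n * f ((L.toCLM ^ n) (x n)) := by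
  obtain ⟨C, hC⟩ := f.exists_norm_apply_le
  have hr := L.weight_pos
  have h1 : L.weight * ‖L.toCLM‖ < 1 := by
    rw [weight, inv_mul_lt_one₀ (by positivity)]
    linarith
  refine Summable.of_norm_bounded (g := fun n => (L.weight * ‖L.toCLM‖) ^ n * (C * ‖x‖))
    ((summable_geometric_of_lt_one (by positivity) h1).mul_right _) fun n => ?_
  have h2 : ‖(L.toCLM ^ n) (x n)‖ ≤ ‖L.toCLM‖ ^ n * ‖x‖ := by
    refine le_trans ?_ (mul_le_mul_of_nonneg_left (x.norm_coe_le_norm n) (by positivity))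
    generalize x n = a
    induction n with
    | zero => simp
    | succ n ih =>
      rw [pow_succ' L.toCLM, pow_succ' ‖_‖, mul_assoc]
      exact (L.toCLM.le_opNorm _).trans (by gcongr; exact ih)
  rw [norm_mul, norm_pow, Complex.norm_real, Real.norm_of_nonneg hr.le, mul_pow, mul_assoc]
  gcongr
  refine (hC _).trans ?_
  rw [mul_left_comm]
  gcongr

theorem pow_nonneg (n : ℕ) {a : A} (ha : 0 ≤ a) : 0 ≤ (L.toCLM ^ n) a := by
  induction n with
  | zero => simpa
  | succ n ih =>
    rw [pow_succ']
    exact L.nonneg _ ih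

attribute [local instance] CStarAlgebra.spectralOrder CStarAlgebra.spectralOrderedRing in
/-- The positive functional `x ↦ ∑ rⁿ f(Lⁿ(xₙ))` on the C⋆-algebra of bounded sequences in `A`. The
latter is given the order whose positive elements are the elements `y⋆ y`. -/
def fockFunctional : (ℕ →ᵇ A) →ₚ[ℂ] ℂ :=
  PositiveLinearMap.mk₀
    { toFun := fun x => ∑' n, (L.weight : ℂ) ^ n * f ((L.toCLM ^ n) (x n))
      map_add' := fun x y => by
        rw [← (L.summable_fock f x).tsum_add (L.summable_fock f y)]
        simp [mul_add]
      map_smul' := fun c x => by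
        rw [RingHom.id_apply, smul_eq_mul, ← tsum_mul_left]
        simp [mul_left_comm] }
    fun x hx => by
      obtain ⟨y, rfl⟩ := CStarAlgebra.nonneg_iff_eq_star_mul_self.1 hx
      refine tsum_nonneg fun n => ?_
      have h1 : (0 : ℂ) ≤ f ((L.toCLM ^ n) (star (y n) * y n)) :=
        f.map_nonneg (L.pow_nonneg n (star_mul_self_nonneg (y n)))
      have h2 : (0 : ℂ) ≤ (L.weight : ℂ) ^ n := by
        have := L.weight_pos
        exact_mod_cast (by positivity : (0 : ℝ) ≤ L.weight ^ n)
      exact mul_nonneg h2 h1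

/-- The relation `S⋆ a S = L(a)` up to the weight, which comes from the shift of the index and from
`L(α(x)⋆ a α(y)) = x⋆ L(a) y`. -/
theorem fockFunctional_shift (x y : ℕ →ᵇ A) (a : A) :
    L.fockFunctional f (star (shift α x) * (constSeq a * shift α y)) =
      L.weight * L.fockFunctional f (star x * (constSeq (L a) * y)) := by
  change ∑' n, (L.weight : ℂ) ^ n * f ((L.toCLM ^ n) (star (shift α x n) * (a * shift α y n))) =
    L.weight * ∑' n, (L.weight : ℂ) ^ n * f ((L.toCLM ^ n) (star (x n) * (L a * y n)))
  refine (L.summable_fock f (star (shift α x) * (constSeq a * shift α y))).tsum_eq_zero_add.trans ?_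
  change (L.weight : ℂ) ^ 0 * f ((L.toCLM ^ 0) (star (shift α x 0) * (a * shift α y 0))) +
    ∑' n, (L.weight : ℂ) ^ (n + 1) *
      f ((L.toCLM ^ (n + 1)) (star (shift α x (n + 1)) * (a * shift α y (n + 1)))) = _
  rw [← tsum_mul_left]
  simp only [shift_zero, shift_succ, map_zero, mul_zero, zero_add]
  refine tsum_congr fun n => ?_
  have h : L (star (α (x n)) * (a * α (y n))) = star (x n) * (L a * y n) := by
    rw [← StarHomClass.map_star α, L.transfer, L.transfer_right]
  rw [pow_succ L.toCLM, pow_succ', mul_assoc, mul_apply_eq_comp, h]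

attribute [local instance] CStarAlgebra.spectralOrder CStarAlgebra.spectralOrderedRing

theorem inner_shift (x y : (L.fockFunctional f).PreGNS) (a : A) :
    inner ℂ ((L.fockFunctional f).toPreGNS (shift α ((L.fockFunctional f).ofPreGNS x)))
      ((L.fockFunctional f).toPreGNS
        (constSeq a * shift α ((L.fockFunctional f).ofPreGNS y))) =
      L.weight * inner ℂ x
        ((L.fockFunctional f).toPreGNS (constSeq (L a) * (L.fockFunctional f).ofPreGNS y)) :=
  L.fockFunctional_shift f _ _ a

/-- The shift as a bounded operator on the pre-Hilbert space of the functional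
`fockFunctional`. The factor `r ^ (-1/2)` compensates for the weights of the functional. -/
def preFockShift : (L.fockFunctional f).PreGNS →L[ℂ] (L.fockFunctional f).PreGNS :=
  ((√L.weight)⁻¹ : ℂ) •
  ((L.fockFunctional f).toPreGNS.toLinearMap ∘ₗ shift α ∘ₗ
    (L.fockFunctional f).ofPreGNS.toLinearMap).mkContinuous
    √(L.weight * ‖(L.fockFunctional f).leftMulMapPreGNS (constSeq (L 1))‖) fun x => by
      have hr := L.weight_pos
      refine le_of_sq_le_sq ?_ (by positivity)
      rw [mul_pow, Real.sq_sqrt (by positivity), ← inner_self_eq_norm_sq (𝕜 := ℂ)]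
      have h := L.inner_shift f x x 1
      rw [map_one, one_mul] at h
      refine (congrArg RCLike.re h).trans_le ((RCLike.re_le_norm _).trans ?_)
      rw [norm_mul, Complex.norm_real, Real.norm_of_nonneg hr.le, mul_assoc]
      gcongr
      refine (norm_inner_le_norm _ _).trans ?_
      rw [pow_two, ← mul_assoc, mul_comm]
      gcongr
      exact ((L.fockFunctional f).leftMulMapPreGNS (constSeq (L 1))).le_opNorm x

theorem preFockShift_apply (x : (L.fockFunctional f).PreGNS) :
    L.preFockShift f x = ((√L.weight)⁻¹ : ℂ) •
      (L.fockFunctional f).toPreGNS (shift α ((L.fockFunctional f).ofPreGNS x)) := rfl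

theorem inner_preFockShift (x y : (L.fockFunctional f).PreGNS) (a : A) :
    inner ℂ (L.preFockShift f x)
      ((L.fockFunctional f).leftMulMapPreGNS (constSeq a) (L.preFockShift f y)) =
      inner ℂ x ((L.fockFunctional f).leftMulMapPreGNS (constSeq (L a)) y) := by
  have hr : (√L.weight : ℂ) * √L.weight = L.weight := by
    rw [← Complex.ofReal_mul, Real.mul_self_sqrt L.weight_pos.le]
  have hr0 : (L.weight : ℂ) ≠ 0 := by exact_mod_cast L.weight_pos.ne'
  rw [preFockShift_apply, preFockShift_apply, map_smul, inner_smul_left, inner_smul_right]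
  refine (congrArg _ (congrArg _ (L.inner_shift f x y a))).trans ?_
  rw [map_inv₀, Complex.conj_ofReal, ← mul_assoc, ← mul_inv, ← mul_assoc, hr,
    inv_mul_cancel₀ hr0, one_mul]
  rfl

/-- The Fock representation: the GNS representation of constant sequences, together with the
shift. -/
def fockRep : ToeplitzCovariantRep L where
  B := (L.fockFunctional f).GNS →L[ℂ] (L.fockFunctional f).GNS
  ρ := (L.fockFunctional f).gnsStarAlgHom.comp constSeq
  V := (L.preFockShift f).completion
  tc1 a := by
    ext x
    induction x using UniformSpace.Completion.induction_on with
    | hp => apply isClosed_eq <;> fun_prop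
    | ih x =>
      have h : shift α (constSeq a * (L.fockFunctional f).ofPreGNS x) =
          constSeq (α a) * shift α ((L.fockFunctional f).ofPreGNS x) := by
        ext (_ | n)
        · exact (mul_zero _).symm
        · exact map_mul α _ _
      simp [preFockShift_apply, h]
  tc2 a := by
    ext x
    refine ext_inner_left ℂ fun y => ?_
    rw [ContinuousLinearMap.star_eq_adjoint]
    simp only [mul_apply_eq_comp, ContinuousLinearMap.adjoint_inner_right]
    induction x, y using UniformSpace.Completion.induction_on₂ with
    | hp => apply isClosed_eq <;> fun_prop
    | ih x y => simpa using L.inner_preFockShift f y x a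

/-- The vector `(1, 0, 0, …)` detects `f(a⋆a)`. -/
theorem fockRep_ρ_ne_zero {a : A} (ha : f (star a * a) ≠ 0) : (L.fockRep f).ρ a ≠ 0 := by
  classical
  intro h
  set F := L.fockFunctional f
  let e : ℕ →ᵇ A := ofNormedAddCommGroupDiscrete (fun n => if n = 0 then 1 else 0) ‖(1 : A)‖
    fun n => by split_ifs <;> simp
  have h1 : ((F.toPreGNS (constSeq a * e) : F.PreGNS) : F.GNS) = 0 := by
    have h0 : F.gnsStarAlgHom (constSeq a) (F.toPreGNS e) = 0 := by
      rw [show F.gnsStarAlgHom (constSeq a) = 0 from h, zero_apply]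
    simpa using h0
  have h2 : F (star (constSeq a * e) * (constSeq a * e)) = 0 := by
    have h3 : ‖F.toPreGNS (constSeq a * e)‖ = 0 := by
      rw [← UniformSpace.Completion.norm_coe, h1, norm_zero]
    have h4 := F.preGNS_norm_sq (F.toPreGNS (constSeq a * e))
    rw [h3] at h4
    simpa using h4.symm
  refine ha (Eq.trans ?_ h2)
  change _ = ∑' n, (L.weight : ℂ) ^ n * f ((L.toCLM ^ n) (star (a * e n) * (a * e n)))
  rw [tsum_eq_single 0]
  · simp [e]
  · intro n hn
    simp [e, hn]

end Fock
end TransferOperator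

/-! ### Universal C⋆-algebras of families of representations -/

namespace RepFamily

variable {G : Type u} (F : RepFamily.{u, v, w} G)

/-- Evaluation of the universal C⋆-algebra at the `i`-th member of the family. -/
def evalHom (i : F.ι) : F.Universal →⋆ₙₐ[ℂ] F.alg i where
  toFun x := (F.equiv x : lp F.alg ∞) i
  map_smul' c x := by rw [equiv_smul]; rfl
  map_zero' := by
    have h : F.equiv 0 = 0 := by simpa using F.equiv_smul 0 0
    rw [h]; rfl
  map_add' x y := by rw [equiv_add]; rfl
  map_mul' x y := by rw [equiv_mul]; rfl
  map_star' x := by rw [equiv_star]; rfl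

@[simp]
theorem evalHom_univGen (i : F.ι) (x : G) : F.evalHom i (F.univGen x) = F.gen i x := by
  change (F.equiv (F.equiv.symm _) : lp F.alg ∞) i = _
  rw [Equiv.apply_symm_apply]
  rfl

variable {F} in
theorem ext_evalHom {x y : F.Universal} (h : ∀ i, F.evalHom i x = F.evalHom i y) : x = y :=
  F.equiv.injective (Subtype.ext (lp.ext (funext h)))

/-- The inclusion of the universal C⋆-algebra in the bounded product. -/
def inclLp : F.Universal →⋆ₙₐ[ℂ] lp F.alg ∞ where
  toFun x := F.equiv x
  map_smul' c x := by rw [equiv_smul]; rfl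
  map_zero' := by
    have h : F.equiv 0 = 0 := by simpa using F.equiv_smul 0 0
    rw [h]; rfl
  map_add' x y := by rw [equiv_add]; rfl
  map_mul' x y := by rw [equiv_mul]; rfl
  map_star' x := by rw [equiv_star]; rfl

theorem isometry_inclLp : Isometry F.inclLp :=
  AddMonoidHomClass.isometry_of_norm F.inclLp F.norm_equiv

/-- The universal C⋆-algebra is generated by the image of `G`. -/
theorem mem_of_univGen_mem (D : NonUnitalStarSubalgebra ℂ F.Universal)
    (hD : IsClosed (D : Set F.Universal)) (h : ∀ g, F.univGen g ∈ D) (x : F.Universal) :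
    x ∈ D := by
  have h1 : F.subalgebra ≤ D.map F.inclLp := by
    refine NonUnitalStarSubalgebra.topologicalClosure_minimal _ (NonUnitalStarAlgebra.adjoin_le ?_) ?_
    · rintro _ ⟨g, rfl⟩
      refine ⟨F.univGen g, h g, ?_⟩
      change (F.equiv (F.equiv.symm _) : lp F.alg ∞) = _
      rw [Equiv.apply_symm_apply]
    · exact F.isometry_inclLp.isClosedEmbedding.isClosedMap _ hD
  obtain ⟨y, hy, hyx⟩ := h1 (F.equiv x).2
  rwa [← F.isometry_inclLp.injective hyx]

theorem hom_ext {B : Type*} [NonUnitalCStarAlgebra B] {g h : F.Universal →⋆ₙₐ[ℂ] B}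
    (hgh : ∀ x, g (F.univGen x) = h (F.univGen x)) : g = h :=
  NonUnitalStarAlgHom.ext fun x =>
    F.mem_of_univGen_mem (NonUnitalStarAlgHom.equalizer g h)
      (isClosed_eq (map_continuous g) (map_continuous h)) hgh x

end RepFamily

/-! ### The map `(ψ, π)⁽¹⁾` on compact operators -/

namespace HilbertModule

open PreHilbertModule

variable {A : Type u} {X : Type v} {B : Type w} [NonUnitalCStarAlgebra A] [PartialOrder A]
  [StarOrderedRing A] [NormedAddCommGroup X] [NormedSpace ℂ X] [CompleteSpace X]
  [NonUnitalCStarAlgebra B]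

theorem compacts_hom_ext [HilbertModule A X] {f g : compacts A X →L[ℂ] B}
    (h : ∀ x y, f ⟨theta A x y, theta_mem_compacts x y⟩ = g ⟨theta A x y, theta_mem_compacts x y⟩) :
    f = g := by
  refine ContinuousLinearMap.coeFn_injective
    ((denseRange_thetaSum (A := A) (X := X)).equalizer f.continuous g.continuous ?_)
  have : f.toLinearMap ∘ₗ thetaSum A X = g.toLinearMap ∘ₗ thetaSum A X := by
    ext p
    simpa [thetaSum] using h p.1 p.2
  exact funext fun s => LinearMap.congr_fun this s

variable [HilbertBimodule A X] {ψ : X →ₗ[ℂ] B} {π : A →⋆ₙₐ[ℂ] B}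

/-- `(ψ, π)⁽¹⁾(T)` acts on `ψ(X)` as `T` does on `X`. -/
theorem onePart_mul (h : IsToeplitzRep ψ π) (T : compacts A X) (x : X) :
    onePart h T * ψ x = ψ ((T : X →L[ℂ] X) x) := by
  let ψ' : X →L[ℂ] B := ψ.mkContinuous 1 fun x => by rw [one_mul]; exact h.norm_le x
  let f : compacts A X →L[ℂ] B := ((ContinuousLinearMap.mul ℂ B).flip (ψ x)).comp (onePart h)
  let g : compacts A X →L[ℂ] B :=
    ψ'.comp ((ContinuousLinearMap.apply ℂ X x).comp (compacts A X).subtypeL)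
  have : f = g := compacts_hom_ext fun y z => by
    change onePart h _ * ψ x = ψ (theta A y z x)
    rw [onePart_theta, theta_apply, h.map_act, ← h.star_mul, mul_assoc]
  exact DFunLike.congr_fun this T

/-- The map `(ψ, π)⁽¹⁾` is natural in the representation. -/
theorem map_onePart {C : Type*} [NonUnitalCStarAlgebra C] (g : B →⋆ₙₐ[ℂ] C)
    {ψ' : X →ₗ[ℂ] C} {π' : A →⋆ₙₐ[ℂ] C} (h : IsToeplitzRep ψ π) (h' : IsToeplitzRep ψ' π')
    (hg : ∀ x, g (ψ x) = ψ' x) (T : compacts A X) : g (onePart h T) = onePart h' T := by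
  let g' : B →L[ℂ] C := ⟨g, map_continuous g⟩
  have : g'.comp (onePart h) = onePart h' := compacts_hom_ext fun y z => by
    change g (onePart h _) = _
    rw [onePart_theta, onePart_theta, map_mul, StarHomClass.map_star, hg, hg]
  exact DFunLike.congr_fun this T

theorem IsToeplitzRep.norm_eq (h : IsToeplitzRep ψ π) (hπ : Function.Injective π) (x : X) :
    ‖ψ x‖ = ‖x‖ := by
  refine (sq_eq_sq₀ (norm_nonneg _) (norm_nonneg _)).1 ?_
  rw [pow_two, ← CStarRing.norm_star_mul_self, h.star_mul, norm_sq_eq (A := A),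
    NonUnitalStarAlgHom.norm_map π hπ]

/-- If `π` is injective, then `ψ` is isometric, and `(ψ, π)⁽¹⁾(T) ψ(x) = ψ(T x)` bounds `‖T‖`. -/
theorem norm_le_norm_onePart (h : IsToeplitzRep ψ π) (hπ : Function.Injective π)
    (T : compacts A X) : ‖T‖ ≤ ‖onePart h T‖ := by
  refine ContinuousLinearMap.opNorm_le_bound _ (norm_nonneg _) fun x => ?_
  change ‖(T : X →L[ℂ] X) x‖ ≤ _
  rw [← h.norm_eq hπ, ← h.norm_eq hπ x, ← onePart_mul h]
  exact norm_mul_le _ _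

theorem isClosed_range_onePart (h : IsToeplitzRep ψ π) (hπ : Function.Injective π) :
    IsClosed (Set.range (onePart h)) := by
  have : CompleteSpace (compacts A X) :=
    (Submodule.isClosed_topologicalClosure _).completeSpace_coe
  refine AntilipschitzWith.isClosed_range (K := 1) ?_ (onePart h).uniformContinuous
  refine AddMonoidHomClass.antilipschitz_of_bound (onePart h) fun T => ?_
  rw [NNReal.coe_one, one_mul]
  exact norm_le_norm_onePart h hπ T

end HilbertModule

/-! ### The universal representation in `𝓞(K, X)` -/

open HilbertModule PreHilbertModule

namespace RelCuntzPimsner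

variable {A X : Type u} [NonUnitalCStarAlgebra A] [PartialOrder A]
  [StarOrderedRing A] [NormedAddCommGroup X] [NormedSpace ℂ X] [CompleteSpace X]
  [HilbertBimodule A X] (K : TwoSidedIdeal A) (hK : K ≤ JIdeal A X)

/-- The `*`-homomorphism of `𝓞(K, X)` given by a representation that is coisometric on `K`. -/
def lift (r : CoisometricRep A X K hK) : RelCuntzPimsner A X K hK →⋆ₙₐ[ℂ] r.B :=
  (coisometricFamily A X K hK).evalHom r

theorem lift_kX (r : CoisometricRep A X K hK) (x : X) : lift K hK r (kX K hK x) = r.ψ x :=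
  (coisometricFamily A X K hK).evalHom_univGen r _

theorem lift_kA (r : CoisometricRep A X K hK) (a : A) : lift K hK r (kA K hK a) = r.π a :=
  (coisometricFamily A X K hK).evalHom_univGen r _

variable {K hK} in
theorem ext_lift {x y : RelCuntzPimsner A X K hK}
    (h : ∀ r : CoisometricRep A X K hK, lift K hK r x = lift K hK r y) : x = y :=
  RepFamily.ext_evalHom h

/-- The map `k_X` as a linear map. -/
def kXₗ : X →ₗ[ℂ] RelCuntzPimsner A X K hK where
  toFun := kX K hK
  map_add' x y := ext_lift fun r => by simp [lift_kX]
  map_smul' c x := ext_lift fun r => by simp [lift_kX]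

/-- The map `k_A` as a `*`-homomorphism. -/
def kAHom : A →⋆ₙₐ[ℂ] RelCuntzPimsner A X K hK where
  toFun := kA K hK
  map_smul' c x := ext_lift fun r => by simp [lift_kA]
  map_zero' := ext_lift fun r => by simp [lift_kA]
  map_add' x y := ext_lift fun r => by simp [lift_kA]
  map_mul' x y := ext_lift fun r => by simp [lift_kA]
  map_star' x := ext_lift fun r => by simp [lift_kA, map_star]

theorem kXₗ_apply (x : X) : kXₗ K hK x = kX K hK x := rfl

theorem kAHom_apply (a : A) : kAHom K hK a = kA K hK a := rfl

theorem isToeplitzRep : IsToeplitzRep (kXₗ K hK) (kAHom K hK) where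
  map_act x a := ext_lift fun r => by
    rw [map_mul, kXₗ_apply, kXₗ_apply, kAHom_apply, lift_kX, lift_kX, lift_kA, r.toeplitz.map_act]
  star_mul x y := ext_lift fun r => by
    rw [map_mul, map_star, kXₗ_apply, kXₗ_apply, kAHom_apply, lift_kX, lift_kX, lift_kA,
      r.toeplitz.star_mul]
  map_φ a x := ext_lift fun r => by
    rw [map_mul, kXₗ_apply, kXₗ_apply, kAHom_apply, lift_kX, lift_kX, lift_kA, r.toeplitz.map_φ]

theorem continuous_kX : Continuous (kX K hK (X := X)) :=
  AddMonoidHomClass.continuous_of_bound (kXₗ K hK) 1 fun x => by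
    rw [one_mul]; exact (isToeplitzRep K hK).norm_le x

/-- The canonical representation of `X` in `𝓞(K, X)` is coisometric on `K`. -/
theorem coisometric (a : A) (ha : a ∈ K) :
    onePart (isToeplitzRep K hK) ⟨HilbertBimodule.φ a, (mem_JIdeal A X a).1 (hK ha)⟩ =
      kA K hK a :=
  ext_lift fun r => by
    rw [map_onePart (lift K hK r) (isToeplitzRep K hK) r.toeplitz (lift_kX K hK r), lift_kA,
      r.coisometric a ha]

end RelCuntzPimsner

/-! ### Toeplitz representations of `M_L` from covariant pairs -/

namespace TransferOperator

variable {A : Type u} [CStarAlgebra A] [PartialOrder A] [StarOrderedRing A]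
  {α : A →⋆ₙₐ[ℂ] A} (L : TransferOperator α)

variable {L} in
@[elab_as_elim]
theorem q_induction {p : L.M → Prop} (x : L.M) (hp : IsClosed {x | p x})
    (h : ∀ a : A, p (L.q a)) : p x :=
  M_induction x hp fun m => h (L.ofAL m)

/-- The right action on `M_L` is unital even if `α` is not: `q(a α(1)) = q(a)`. -/
theorem act_one (x : L.M) : act x (1 : A) = x :=
  ext_ip (A := A) fun z => by rw [ip_act_right, mul_one]

theorem φ_one (x : L.M) : HilbertBimodule.φ (1 : A) x = x := by
  refine q_induction x (isClosed_eq (by fun_prop) (by fun_prop)) fun a => ?_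
  rw [φ_q, one_mul]

section Represent

variable {B : Type w} [NonUnitalCStarAlgebra B]

/-- The linear map `q(a) ↦ π(a) V` of `M_L` given by a homomorphism `π` of `A` and an element `V`
with `V⋆ π(a) V = π(L(a))`. -/
def ofCovariant (π : A →⋆ₙₐ[ℂ] B) (V : B) (hV : ∀ a, star V * π a * V = π (L a)) :
    L.M →L[ℂ] B :=
  (LinearMap.mkContinuous
    ({ toFun := fun m => π (L.ofAL m) * V
       map_add' := fun x y => by rw [map_add, map_add, add_mul]
       map_smul' := fun c x => by rw [map_smul, map_smul, smul_mul_assoc]; rfl } : L.AL →ₗ[ℂ] B) 1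
    fun m => by
      rw [one_mul]
      refine le_of_sq_le_sq ?_ (norm_nonneg _)
      change ‖π (L.ofAL m) * V‖ ^ 2 ≤ _
      rw [pow_two, ← CStarRing.norm_star_mul_self, star_mul, mul_assoc, ← mul_assoc _ _ V,
        ← StarHomClass.map_star π, ← map_mul, ← mul_assoc, hV, norm_sq_AL, ip_AL]
      exact NonUnitalStarAlgHom.norm_apply_le π _).extend L.qAL

variable {π : A →⋆ₙₐ[ℂ] B} {V : B} (hV : ∀ a, star V * π a * V = π (L a))

theorem ofCovariant_q (a : A) : L.ofCovariant π V hV (L.q a) = π a * V :=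
  ContinuousLinearMap.extend_eq _ L.denseRange_qAL L.isUniformInducing_qAL _

theorem continuous_act (a : A) : Continuous fun x : L.M => act x a :=
  (L.extendM (L.rightAL a)).continuous

theorem continuous_ip {Y : Type*} [TopologicalSpace Y] {f g : Y → L.M} (hf : Continuous f)
    (hg : Continuous g) : Continuous fun y => ip (A := A) (f y) (g y) :=
  L.continuous_ipM' hf hg

/-- If moreover `V π(a) = π(α(a)) V`, then `q(a) ↦ π(a) V` is part of a Toeplitz representation. -/
theorem isToeplitzRep_ofCovariant (hα : ∀ a, V * π a = π (α a) * V) :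
    IsToeplitzRep (L.ofCovariant π V hV : L.M →ₗ[ℂ] B) π where
  map_act x a := by
    refine q_induction x ?_ fun b => ?_
    · exact isClosed_eq ((L.ofCovariant π V hV).continuous.comp (L.continuous_act a))
        ((L.ofCovariant π V hV).continuous.mul_const _)
    · change L.ofCovariant π V hV _ = L.ofCovariant π V hV _ * _
      rw [q_act, ofCovariant_q, ofCovariant_q, map_mul, mul_assoc, mul_assoc, hα]
  star_mul x y := by
    refine q_induction x ?_ fun a => q_induction y ?_ fun b => ?_
    · exact isClosed_eq ((L.ofCovariant π V hV).continuous.star.mul continuous_const)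
        ((map_continuous π).comp (L.continuous_ip continuous_id continuous_const))
    · exact isClosed_eq (continuous_const.mul (L.ofCovariant π V hV).continuous)
        ((map_continuous π).comp (L.continuous_ip continuous_const continuous_id))
    · change star (L.ofCovariant π V hV _) * L.ofCovariant π V hV _ = _
      rw [ofCovariant_q, ofCovariant_q, ip_q, star_mul, mul_assoc, ← mul_assoc _ _ V,
        ← StarHomClass.map_star π, ← map_mul, ← mul_assoc, hV]
  map_φ a x := by
    refine q_induction x ?_ fun b => ?_
    · exact isClosed_eq
        ((L.ofCovariant π V hV).continuous.comp (HilbertBimodule.φ (X := L.M) a).continuous)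
        (continuous_const.mul (L.ofCovariant π V hV).continuous)
    · change L.ofCovariant π V hV _ = _ * L.ofCovariant π V hV _
      rw [φ_q, ofCovariant_q, ofCovariant_q, map_mul, mul_assoc]

end Represent

end TransferOperator

/-! ### The Toeplitz algebra and its redundancies -/

namespace TransferOperator

variable {A : Type u} [CStarAlgebra A] [PartialOrder A] [StarOrderedRing A]
  {α : A →⋆ₙₐ[ℂ] A} (L : TransferOperator α)

/-- The `*`-homomorphism of `𝓣(A, α, L)` given by a Toeplitz-covariant representation. -/
def toeplitzLift (r : ToeplitzCovariantRep L) : L.ToeplitzAlgebra →⋆ₙₐ[ℂ] r.B :=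
  L.toeplitzFamily.evalHom r

theorem toeplitzLift_iA (r : ToeplitzCovariantRep L) (a : A) :
    L.toeplitzLift r (L.iA a) = r.ρ a :=
  L.toeplitzFamily.evalHom_univGen r _

theorem toeplitzLift_S (r : ToeplitzCovariantRep L) : L.toeplitzLift r L.S = r.V :=
  L.toeplitzFamily.evalHom_univGen r _

variable {L} in
theorem ext_toeplitzLift {x y : L.ToeplitzAlgebra}
    (h : ∀ r : ToeplitzCovariantRep L, L.toeplitzLift r x = L.toeplitzLift r y) : x = y :=
  RepFamily.ext_evalHom h

/-- The map `i_A` as a `*`-homomorphism. -/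
def iAHom : A →⋆ₙₐ[ℂ] L.ToeplitzAlgebra where
  toFun := L.iA
  map_smul' c x := ext_toeplitzLift fun r => by simp [toeplitzLift_iA]
  map_zero' := ext_toeplitzLift fun r => by simp [toeplitzLift_iA]
  map_add' x y := ext_toeplitzLift fun r => by simp [toeplitzLift_iA]
  map_mul' x y := ext_toeplitzLift fun r => by simp [toeplitzLift_iA]
  map_star' x := ext_toeplitzLift fun r => by simp [toeplitzLift_iA, StarHomClass.map_star]

theorem iAHom_apply (a : A) : L.iAHom a = L.iA a := rfl

theorem S_mul_iA (a : A) : L.S * L.iAHom a = L.iAHom (α a) * L.S :=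
  ext_toeplitzLift fun r => by
    rw [map_mul, map_mul, iAHom_apply, iAHom_apply, toeplitzLift_S, toeplitzLift_iA,
      toeplitzLift_iA, r.tc1]

theorem star_S_mul_iA_mul_S (a : A) : star L.S * L.iAHom a * L.S = L.iAHom (L a) :=
  ext_toeplitzLift fun r => by
    rw [map_mul, map_mul, StarHomClass.map_star, iAHom_apply, iAHom_apply, toeplitzLift_S,
      toeplitzLift_iA, toeplitzLift_iA, r.tc2]

/-- The Fock representations of all positive functionals of `A` separate the points of `A`. -/
theorem injective_iAHom : Function.Injective L.iAHom := by
  refine (injective_iff_map_eq_zero _).2 fun a ha => ?_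
  by_contra h0
  obtain ⟨f, hf⟩ := exists_positiveLinearMap_ne_zero h0
  refine L.fockRep_ρ_ne_zero f hf ?_
  rw [← toeplitzLift_iA, ← iAHom_apply, ha, map_zero]

/-- The Toeplitz representation `(q(a) ↦ i_A(a) S, i_A)` of `M_L` in `𝓣(A, α, L)`. -/
abbrev iM : L.M →L[ℂ] L.ToeplitzAlgebra := L.ofCovariant L.iAHom L.S L.star_S_mul_iA_mul_S

theorem iM_q (a : A) : L.iM (L.q a) = L.iA a * L.S := L.ofCovariant_q _ a

theorem isToeplitzRep_iM : IsToeplitzRep (L.iM : L.M →ₗ[ℂ] L.ToeplitzAlgebra) L.iAHom :=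
  L.isToeplitzRep_ofCovariant _ L.S_mul_iA

/-- The closed linear span of `i_A(A) S S⋆ i_A(A)`. -/
abbrev spanSS : Submodule ℂ L.ToeplitzAlgebra :=
  (Submodule.span ℂ {x | ∃ b c : A, x = L.iA b * L.S * star L.S * L.iA c}).topologicalClosure

theorem iM_mul_star_iM_mem (x y : L.M) : L.iM x * star (L.iM y) ∈ L.spanSS := by
  have hc : IsClosed (L.spanSS : Set L.ToeplitzAlgebra) :=
    Submodule.isClosed_topologicalClosure _
  refine q_induction x ?_ fun a => q_induction y ?_ fun b => ?_
  · exact hc.preimage (L.iM.continuous.mul continuous_const)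
  · exact hc.preimage (continuous_const.mul L.iM.continuous.star)
  · refine Submodule.le_topologicalClosure _ (Submodule.subset_span ⟨a, star b, ?_⟩)
    rw [iM_q, iM_q, star_mul, ← iAHom_apply, ← iAHom_apply, ← iAHom_apply,
      StarHomClass.map_star, mul_assoc, mul_assoc, mul_assoc]

theorem onePart_iM_mem (T : compacts A L.M) : onePart L.isToeplitzRep_iM T ∈ L.spanSS := by
  have hc : IsClosed (L.spanSS : Set L.ToeplitzAlgebra) :=
    Submodule.isClosed_topologicalClosure _
  refine (denseRange_thetaSum (A := A) (X := L.M)).induction_on T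
    (hc.preimage (onePart L.isToeplitzRep_iM).continuous) fun s => ?_
  rw [thetaSum, Finsupp.linearCombination_apply, Finsupp.sum, map_sum]
  refine Submodule.sum_mem _ fun p _ => ?_
  rw [map_smul, onePart_theta]
  exact Submodule.smul_mem _ _ (L.iM_mul_star_iM_mem p.1 p.2)

/-- As `i_A` is injective, the closed linear span of `i_A(A) S S⋆ i_A(A)` is the image of the
compact operators. -/
theorem exists_onePart_iM_eq {k : L.ToeplitzAlgebra} (hk : k ∈ L.spanSS) :
    ∃ T, onePart L.isToeplitzRep_iM T = k := by
  have h : Submodule.span ℂ {x | ∃ b c : A, x = L.iA b * L.S * star L.S * L.iA c} ≤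
      (onePart L.isToeplitzRep_iM).toLinearMap.range := by
    rw [Submodule.span_le]
    rintro _ ⟨b, c, rfl⟩
    refine ⟨⟨theta A (L.q b) (L.q (star c)), theta_mem_compacts _ _⟩, ?_⟩
    refine (onePart_theta _ _ _).trans ?_
    change L.iM _ * star (L.iM _) = _
    rw [iM_q, iM_q, star_mul, ← iAHom_apply, ← iAHom_apply, ← iAHom_apply,
      StarHomClass.map_star, star_star, mul_assoc, mul_assoc, mul_assoc]
  exact closure_minimal h (isClosed_range_onePart _ L.injective_iAHom) hk

/-- Redundancies come from compact operators: `(i_A(a), k)` is a redundancy exactly if `φ(a)` is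
compact and `k` is its image. -/
theorem isRedundancy_iff (a : A) (k : L.ToeplitzAlgebra) :
    L.IsRedundancy a k ↔ ∃ ha : a ∈ JIdeal A L.M,
      k = onePart L.isToeplitzRep_iM ⟨HilbertBimodule.φ a, (mem_JIdeal A L.M a).1 ha⟩ := by
  have hφ : ∀ x, L.iA a * L.iM x = L.iM (HilbertBimodule.φ a x) := fun x =>
    (L.isToeplitzRep_iM.map_φ a x).symm
  constructor
  · rintro ⟨hk, h⟩
    -- `k` is the image of some compact `T`, and `i_M(T q(b)) = k i_A(b) S = i_M(φ(a) q(b))`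
    obtain ⟨T, rfl⟩ := L.exists_onePart_iM_eq hk
    have hT : (T : L.M →L[ℂ] L.M) = HilbertBimodule.φ a := by
      ext x
      refine q_induction x (isClosed_eq (by fun_prop) (by fun_prop)) fun b => ?_
      rw [← sub_eq_zero, ← norm_eq_zero, ← L.isToeplitzRep_iM.norm_eq L.injective_iAHom, map_sub,
        ← onePart_mul L.isToeplitzRep_iM, norm_eq_zero, sub_eq_zero]
      change _ * L.iM _ = L.iM _
      rw [← hφ, iM_q, ← mul_assoc, ← mul_assoc, h]
    have ha : a ∈ JIdeal A L.M := by
      rw [mem_JIdeal, ← hT]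
      exact T.2
    exact ⟨ha, congrArg _ (Subtype.ext hT)⟩
  · rintro ⟨ha, rfl⟩
    refine ⟨L.onePart_iM_mem _, fun b => ?_⟩
    rw [mul_assoc, mul_assoc, ← iM_q, hφ]
    exact (onePart_mul L.isToeplitzRep_iM ⟨HilbertBimodule.φ a, _⟩ (L.q b)).symm

theorem mem_Kα (a : A) : a ∈ L.Kα ↔ a ∈ spanAαA α ∧ a ∈ JIdeal A L.M :=
  TwoSidedIdeal.mem_mk' ..

/-! ### The crossed product -/

/-- The quotient map as a `*`-homomorphism. -/
def QHom : L.ToeplitzAlgebra →⋆ₙₐ[ℂ] L.CrossedProduct where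
  toFun := L.Q
  map_smul' _ _ := rfl
  map_zero' := rfl
  map_add' _ _ := rfl
  map_mul' _ _ := rfl
  map_star' _ := rfl

theorem Q_surjective : Function.Surjective L.Q := Ideal.Quotient.mk_surjective

/-- The map `j_A` as a `*`-homomorphism. -/
def jAHom : A →⋆ₙₐ[ℂ] L.CrossedProduct := L.QHom.comp L.iAHom

theorem T_mul_jA (a : A) : L.T * L.jAHom a = L.jAHom (α a) * L.T :=
  (map_mul L.QHom _ _).symm.trans ((congrArg L.QHom (L.S_mul_iA a)).trans (map_mul L.QHom _ _))

theorem star_T_mul_jA_mul_T (a : A) : star L.T * L.jAHom a * L.T = L.jAHom (L a) := by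
  have := congrArg L.QHom (L.star_S_mul_iA_mul_S a)
  rwa [map_mul, map_mul, StarHomClass.map_star] at this

/-- The Toeplitz representation `(q(a) ↦ j_A(a) T, j_A)` of `M_L` in the crossed product. -/
abbrev jM : L.M →L[ℂ] L.CrossedProduct := L.ofCovariant L.jAHom L.T L.star_T_mul_jA_mul_T

theorem jM_q (a : A) : L.jM (L.q a) = L.jA a * L.T :=
  L.ofCovariant_q L.star_T_mul_jA_mul_T a

theorem isToeplitzRep_jM : IsToeplitzRep (L.jM : L.M →ₗ[ℂ] L.CrossedProduct) L.jAHom :=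
  L.isToeplitzRep_ofCovariant _ L.T_mul_jA

theorem Q_iM (x : L.M) : L.QHom (L.iM x) = L.jM x := by
  refine q_induction x ?_ fun a => ?_
  · exact isClosed_eq ((map_continuous L.QHom).comp L.iM.continuous) L.jM.continuous
  · rw [iM_q, map_mul]
    exact (L.jM_q a).symm

/-- The canonical representation of `M_L` in the crossed product is coisometric on `K_α`. -/
theorem coisometric_jM {a : A} (ha : a ∈ L.Kα) :
    onePart L.isToeplitzRep_jM ⟨HilbertBimodule.φ a, (mem_JIdeal A L.M a).1 (L.Kα_le ha)⟩ =
      L.jA a := by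
  rw [← map_onePart L.QHom L.isToeplitzRep_iM L.isToeplitzRep_jM L.Q_iM]
  refine ((Ideal.Quotient.mk_eq_mk_iff_sub_mem _ _).2 ?_).symm
  rw [redundancyIdeal, Submodule.mem_sInf]
  rintro I ⟨-, -, hI⟩
  exact hI a _ ((L.mem_Kα a).1 ha).1 ((L.isRedundancy_iff a _).2 ⟨L.Kα_le ha, rfl⟩)

end TransferOperator

/-! ### `𝓞(K, M_L)` as a quotient of the Toeplitz algebra -/

/-- A C⋆-algebra with a two-sided unit, as a unital C⋆-algebra. -/
@[reducible]
def CStarAlgebra.ofUnit {B : Type u} [NonUnitalCStarAlgebra B] (e : B) (h₁ : ∀ x, e * x = x)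
    (h₂ : ∀ x, x * e = x) : CStarAlgebra B :=
  letI : Ring B :=
    { (inferInstance : NonUnitalRing B) with
      one := e
      one_mul := h₁
      mul_one := h₂ }
  letI : Algebra ℂ B :=
    Algebra.ofModule (fun c x y => smul_mul_assoc c x y) (fun c x y => mul_smul_comm c x y)
  { (inferInstance : NonUnitalCStarAlgebra B), (inferInstance : Ring B),
    (inferInstance : Algebra ℂ B) with
    norm_smul_le := fun c x => norm_smul_le c x }

namespace TransferOperator

variable {A : Type u} [CStarAlgebra A] [PartialOrder A] [StarOrderedRing A]
  {α : A →⋆ₙₐ[ℂ] A} (L : TransferOperator α)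

section Unit

variable (K : TwoSidedIdeal A) (hK : K ≤ JIdeal A L.M)

/-- `𝓞(K, M_L)` is generated by `k_A(A)` and the elements `k_M(q(a))`. -/
theorem cuntzPimsner_mem (D : NonUnitalStarSubalgebra ℂ (RelCuntzPimsner A L.M K hK))
    (hD : IsClosed (D : Set (RelCuntzPimsner A L.M K hK)))
    (hA : ∀ a, RelCuntzPimsner.kA K hK a ∈ D) (hq : ∀ a, RelCuntzPimsner.kX K hK (L.q a) ∈ D)
    (x : RelCuntzPimsner A L.M K hK) : x ∈ D := by
  refine RepFamily.mem_of_univGen_mem _ D hD ?_ x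
  rintro (m | a)
  · exact q_induction m (hD.preimage (RelCuntzPimsner.continuous_kX K hK)) hq
  · exact hA a

theorem kX_q (a : A) : RelCuntzPimsner.kX K hK (L.q a) =
    RelCuntzPimsner.kA K hK a * RelCuntzPimsner.kX K hK (L.q 1) := by
  have := (RelCuntzPimsner.isToeplitzRep K hK (X := L.M)).map_φ a (L.q 1)
  rwa [φ_q, mul_one] at this

/-- `k_A(1)` is a unit of `𝓞(K, M_L)`. -/
theorem kA_one_unit (x : RelCuntzPimsner A L.M K hK) :
    RelCuntzPimsner.kA K hK 1 * x = x ∧ x * RelCuntzPimsner.kA K hK 1 = x := by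
  set e := RelCuntzPimsner.kA K hK (1 : A) (X := L.M) with he
  have hstar : star e = e := by
    have := StarHomClass.map_star (RelCuntzPimsner.kAHom K hK (X := L.M)) (1 : A)
    rw [star_one] at this
    exact this.symm
  let D : NonUnitalStarSubalgebra ℂ (RelCuntzPimsner A L.M K hK) :=
    { carrier := {x | e * x = x ∧ x * e = x}
      add_mem' := fun {x y} hx hy => by
        constructor
        · rw [mul_add, hx.1, hy.1]
        · rw [add_mul, hx.2, hy.2]
      zero_mem' := ⟨mul_zero _, zero_mul _⟩
      mul_mem' := fun {x y} hx hy => by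
        constructor
        · rw [← mul_assoc, hx.1]
        · rw [mul_assoc, hy.2]
      smul_mem' := fun c x hx => by
        constructor
        · rw [mul_smul_comm, hx.1]
        · rw [smul_mul_assoc, hx.2]
      star_mem' := fun {x} hx => by
        constructor
        · have := congrArg star hx.2
          rwa [star_mul, hstar] at this
        · have := congrArg star hx.1
          rwa [star_mul, hstar] at this }
  refine L.cuntzPimsner_mem K hK D ?_ (fun a => ⟨?_, ?_⟩) (fun a => ⟨?_, ?_⟩) x
  · exact (isClosed_eq (continuous_const_mul e) continuous_id).inter
      (isClosed_eq (continuous_mul_const e) continuous_id)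
  · rw [he, ← RelCuntzPimsner.kAHom_apply, ← RelCuntzPimsner.kAHom_apply, ← map_mul, one_mul]
  · rw [he, ← RelCuntzPimsner.kAHom_apply, ← RelCuntzPimsner.kAHom_apply, ← map_mul, mul_one]
  · have := (RelCuntzPimsner.isToeplitzRep K hK).map_φ 1 (L.q a)
    rw [L.φ_one] at this
    exact this.symm
  · have := (RelCuntzPimsner.isToeplitzRep K hK).map_act (L.q a) 1
    rw [L.act_one] at this
    exact this.symm

/-- The Toeplitz-covariant representation `(k_A, k_M(q(1)))` in `𝓞(K, M_L)`, where the latter is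
regarded as a unital C⋆-algebra with unit `k_A(1)`. -/
def cuntzPimsnerRep : ToeplitzCovariantRep L where
  B := RelCuntzPimsner A L.M K hK
  cstar := CStarAlgebra.ofUnit (RelCuntzPimsner.kA K hK 1) (fun x => (L.kA_one_unit K hK x).1)
    fun x => (L.kA_one_unit K hK x).2
  ρ :=
    letI := CStarAlgebra.ofUnit (RelCuntzPimsner.kA K hK 1) (fun x => (L.kA_one_unit K hK x).1)
      fun x => (L.kA_one_unit K hK x).2
    { RelCuntzPimsner.kAHom K hK with
      map_one' := rfl
      commutes' := fun c => by
        rw [Algebra.algebraMap_eq_smul_one, Algebra.algebraMap_eq_smul_one]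
        exact map_smul (RelCuntzPimsner.kAHom K hK (X := L.M)) c 1 }
  V := RelCuntzPimsner.kX K hK (L.q 1)
  tc1 a := by
    change RelCuntzPimsner.kX K hK (L.q 1) * RelCuntzPimsner.kA K hK a =
      RelCuntzPimsner.kA K hK (α a) * RelCuntzPimsner.kX K hK (L.q 1)
    have := (RelCuntzPimsner.isToeplitzRep K hK).map_act (L.q 1) a
    rw [q_act, one_mul] at this
    rw [← kX_q]
    exact this.symm
  tc2 a := by
    change star (RelCuntzPimsner.kX K hK (L.q 1)) * RelCuntzPimsner.kA K hK a *
      RelCuntzPimsner.kX K hK (L.q 1) = RelCuntzPimsner.kA K hK (L a)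
    have := (RelCuntzPimsner.isToeplitzRep K hK).star_mul (L.q 1) (L.q a)
    rw [ip_q, star_one, one_mul] at this
    rw [mul_assoc, ← kX_q]
    exact this

/-- The `*`-homomorphism of the Toeplitz algebra to `𝓞(K, M_L)`. -/
def toCuntzPimsner : L.ToeplitzAlgebra →⋆ₙₐ[ℂ] RelCuntzPimsner A L.M K hK :=
  L.toeplitzLift (L.cuntzPimsnerRep K hK)

theorem toCuntzPimsner_iA (a : A) :
    L.toCuntzPimsner K hK (L.iA a) = RelCuntzPimsner.kA K hK a :=
  L.toeplitzLift_iA (L.cuntzPimsnerRep K hK) a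

theorem toCuntzPimsner_S : L.toCuntzPimsner K hK L.S = RelCuntzPimsner.kX K hK (L.q 1) :=
  L.toeplitzLift_S (L.cuntzPimsnerRep K hK)

theorem toCuntzPimsner_iM (x : L.M) :
    L.toCuntzPimsner K hK (L.iM x) = RelCuntzPimsner.kX K hK x := by
  refine q_induction x ?_ fun a => ?_
  · exact isClosed_eq ((map_continuous _).comp L.iM.continuous)
      (RelCuntzPimsner.continuous_kX K hK)
  · rw [iM_q, map_mul, toCuntzPimsner_iA, toCuntzPimsner_S, ← kX_q]

end Unit

/-- The homomorphism of `𝓣(A, α, L)` to `𝓞(K_α, M_L)` vanishes on the redundancy ideal. -/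
theorem toCuntzPimsner_eq_zero {x : L.ToeplitzAlgebra} (hx : x ∈ L.redundancyIdeal) :
    L.toCuntzPimsner L.Kα L.Kα_le x = 0 := by
  let I : Ideal L.ToeplitzAlgebra :=
    { carrier := {x | L.toCuntzPimsner L.Kα L.Kα_le x = 0}
      add_mem' := fun {x y} hx hy => by
        have hx : L.toCuntzPimsner L.Kα L.Kα_le x = 0 := hx
        have hy : L.toCuntzPimsner L.Kα L.Kα_le y = 0 := hy
        exact (map_add _ x y).trans (by rw [hx, hy, add_zero])
      zero_mem' := map_zero _
      smul_mem' := fun c x hx => by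
        have hx : L.toCuntzPimsner L.Kα L.Kα_le x = 0 := hx
        exact (map_mul _ c x).trans (by rw [hx, mul_zero]) }
  have hI : L.redundancyIdeal ≤ I := by
    refine sInf_le ⟨⟨fun {x} y hx => ?_⟩, ?_, fun a k ha hk => ?_⟩
    · have hx : L.toCuntzPimsner L.Kα L.Kα_le x = 0 := hx
      exact (map_mul _ x y).trans (by rw [hx, zero_mul])
    · exact isClosed_eq (map_continuous (L.toCuntzPimsner L.Kα L.Kα_le)) continuous_const
    · obtain ⟨haJ, rfl⟩ := (L.isRedundancy_iff a k).1 hk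
      have haK : a ∈ L.Kα := (L.mem_Kα a).2 ⟨ha, haJ⟩
      change L.toCuntzPimsner L.Kα L.Kα_le _ = 0
      rw [map_sub, toCuntzPimsner_iA, map_onePart (L.toCuntzPimsner L.Kα L.Kα_le)
        L.isToeplitzRep_iM (RelCuntzPimsner.isToeplitzRep L.Kα L.Kα_le)
        (L.toCuntzPimsner_iM L.Kα L.Kα_le), RelCuntzPimsner.coisometric L.Kα L.Kα_le a haK, sub_self]
  exact hI hx

/-- The `*`-homomorphism of the crossed product to `𝓞(K_α, M_L)`. -/
def crossedProductHom : L.CrossedProduct →⋆ₙₐ[ℂ] RelCuntzPimsner A L.M L.Kα L.Kα_le where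
  toFun := Quotient.lift (L.toCuntzPimsner L.Kα L.Kα_le) fun x y h => by
    rw [← sub_eq_zero, ← map_sub]
    exact L.toCuntzPimsner_eq_zero ((Submodule.quotientRel_def _).1 h)
  map_smul' := by rintro c ⟨x⟩; exact map_smul (L.toCuntzPimsner L.Kα L.Kα_le) c x
  map_zero' := map_zero (L.toCuntzPimsner L.Kα L.Kα_le)
  map_add' := by rintro ⟨x⟩ ⟨y⟩; exact map_add (L.toCuntzPimsner L.Kα L.Kα_le) x y
  map_mul' := by rintro ⟨x⟩ ⟨y⟩; exact map_mul (L.toCuntzPimsner L.Kα L.Kα_le) x y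
  map_star' := by rintro ⟨x⟩; exact StarHomClass.map_star (L.toCuntzPimsner L.Kα L.Kα_le) x

/-- The `*`-homomorphism of `𝓞(K_α, M_L)` to the crossed product. -/
def cuntzPimsnerHom : RelCuntzPimsner A L.M L.Kα L.Kα_le →⋆ₙₐ[ℂ] L.CrossedProduct :=
  RelCuntzPimsner.lift L.Kα L.Kα_le
    { B := L.CrossedProduct
      ψ := (L.jM : L.M →ₗ[ℂ] L.CrossedProduct)
      π := L.jAHom
      toeplitz := L.isToeplitzRep_jM
      coisometric := fun _ ha => L.coisometric_jM ha }

theorem cuntzPimsnerHom_kA (a : A) :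
    L.cuntzPimsnerHom (RelCuntzPimsner.kA L.Kα L.Kα_le a) = L.jA a :=
  RelCuntzPimsner.lift_kA _ _ _ a

theorem cuntzPimsnerHom_kX (x : L.M) :
    L.cuntzPimsnerHom (RelCuntzPimsner.kX L.Kα L.Kα_le x) = L.jM x :=
  RelCuntzPimsner.lift_kX _ _ _ x

theorem jM_q_one : L.jM (L.q 1) = L.T := by
  rw [jM_q]
  exact congrArg L.Q (L.iA_one_mul L.S)

theorem crossedProductHom_T : L.crossedProductHom L.T =
    RelCuntzPimsner.kX L.Kα L.Kα_le (L.q 1) :=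
  L.toCuntzPimsner_S L.Kα L.Kα_le

theorem crossedProductHom_jA (a : A) : L.crossedProductHom (L.jA a) =
    RelCuntzPimsner.kA L.Kα L.Kα_le a :=
  L.toCuntzPimsner_iA L.Kα L.Kα_le a

theorem crossedProductHom_comp_cuntzPimsnerHom (x : RelCuntzPimsner A L.M L.Kα L.Kα_le) :
    L.crossedProductHom (L.cuntzPimsnerHom x) = x := by
  refine L.cuntzPimsner_mem _ _ (NonUnitalStarAlgHom.equalizer
    (L.crossedProductHom.comp L.cuntzPimsnerHom) (NonUnitalStarAlgHom.id ℂ _)) ?_ ?_ ?_ x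
  · exact isClosed_eq (map_continuous _) (map_continuous _)
  · intro a
    change L.crossedProductHom (L.cuntzPimsnerHom _) = _
    rw [cuntzPimsnerHom_kA, crossedProductHom_jA]
    rfl
  · intro a
    change L.crossedProductHom (L.cuntzPimsnerHom _) = _
    rw [cuntzPimsnerHom_kX, jM_q, map_mul, crossedProductHom_jA, crossedProductHom_T, ← kX_q]
    rfl

theorem cuntzPimsnerHom_comp_crossedProductHom (x : L.CrossedProduct) :
    L.cuntzPimsnerHom (L.crossedProductHom x) = x := by
  obtain ⟨x, rfl⟩ := L.Q_surjective x
  have : L.cuntzPimsnerHom.comp (L.toCuntzPimsner L.Kα L.Kα_le) = L.QHom := by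
    refine L.toeplitzFamily.hom_ext ?_
    rintro (_ | a)
    · change L.cuntzPimsnerHom (L.toCuntzPimsner _ _ L.S) = L.T
      rw [toCuntzPimsner_S, cuntzPimsnerHom_kX, jM_q_one]
    · change L.cuntzPimsnerHom (L.toCuntzPimsner _ _ (L.iA a)) = L.jA a
      rw [toCuntzPimsner_iA, cuntzPimsnerHom_kA]
  exact DFunLike.congr_fun this x

/-- The ideal `K` is a variable here so that the case `K = J(M_L)` can be read off when `α` is
unital. -/
theorem exists_starAlgEquiv (K : TwoSidedIdeal A) (hK : K ≤ JIdeal A L.M) (h : K = L.Kα) :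
    ∃ θ : RelCuntzPimsner A L.M K hK ≃⋆ₐ[ℂ] L.CrossedProduct,
      (∀ a : A, θ (RelCuntzPimsner.kA K hK a) = L.jA a) ∧
        θ (RelCuntzPimsner.kX K hK (L.q 1)) = L.T := by
  subst h
  refine ⟨StarAlgEquiv.ofBijective L.cuntzPimsnerHom
    ⟨Function.LeftInverse.injective L.crossedProductHom_comp_cuntzPimsnerHom,
      Function.RightInverse.surjective L.cuntzPimsnerHom_comp_crossedProductHom⟩,
    L.cuntzPimsnerHom_kA, ?_⟩
  exact (L.cuntzPimsnerHom_kX _).trans L.jM_q_one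

/-- If `α(1) = 1`, then `a = a α(1) 1` shows that the span of `A α(A) A` is all of `A`. -/
theorem Kα_eq_JIdeal (h : α 1 = 1) : L.Kα = JIdeal A L.M := by
  refine le_antisymm L.Kα_le fun a ha => (L.mem_Kα a).2 ⟨?_, ha⟩
  exact Submodule.le_topologicalClosure _ (Submodule.subset_span ⟨a, 1, 1, by simp [h]⟩)

end TransferOperator

end

theorem mainTheorem2 {A : Type u} [CStarAlgebra A] [PartialOrder A] [StarOrderedRing A]
    (α : A →⋆ₙₐ[ℂ] A) (L : TransferOperator α) :
    (∃ θ : RelCuntzPimsner A L.M L.Kα L.Kα_le ≃⋆ₐ[ℂ] L.CrossedProduct,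
      (∀ a : A, θ (RelCuntzPimsner.kA L.Kα L.Kα_le a) = L.jA a) ∧
        θ (RelCuntzPimsner.kX L.Kα L.Kα_le (L.q 1)) = L.T) ∧
    (α 1 = 1 → L.Kα = HilbertModule.JIdeal A L.M ∧
      ∃ θ : CuntzPimsner A L.M ≃⋆ₐ[ℂ] L.CrossedProduct,
        (∀ a : A, θ (RelCuntzPimsner.kA (HilbertModule.JIdeal A L.M) le_rfl a) = L.jA a) ∧
          θ (RelCuntzPimsner.kX (HilbertModule.JIdeal A L.M) le_rfl (L.q 1)) = L.T) :=
  ⟨L.exists_starAlgEquiv _ _ rfl, fun h =>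
    ⟨L.Kα_eq_JIdeal h, L.exists_starAlgEquiv _ _ (L.Kα_eq_JIdeal h).symm⟩⟩
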